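/- **Setting.** An instance of offline stochastic matching is a finite simple graph $G=(V,E)$ with edge weights $w_e\ge 0$, edge probabilities $p_e\in[0,1]$ and vertex patiences $t_v\in\{0,1,2,\dots\}\cup\{\infty\}$; each edge $e$ is active independently with probability $p_e$. A *probing algorithm* is a (possibly randomized) adaptive policy that probes edges one at a time, each at most once, and learns upon probing whether the edge is active; an active probed edge is irrevocably matched. An edge may be probed only if both its endpoints $v$ are unmatched and have so far been incident to fewer than $t_v$ probes. Write $\delta(v)$ for the set of edges incident to $v$, and let $\mathsf{LP}$ be the linear program of maximizing $\sum_{e\in E}w_ep_ey_e$ subject to $$\sum_{e\in\delta(v)}p_ey_e\le 1,\qquad \sum_{e\in\delta(v)}y_e\le t_v\qquad(v\in V),\qquad 0\le y_e\le1\qquad(e\in E).$$ **Algorithm.** Let $G$ be bipartite with sides $V_1,V_2$, where $t_u=1$ for all $u\in V_1$. 1. Let $y$ be an optimal solution of $\mathsf{LP}$. 2. Round $y$ to $Y\in\{0,1\}^E$ by the dependent rounding procedure of Gandhi et al.: as long as some edges are floating (have value strictly between $0$ and $1$), choose in the graph of floating edges a cycle, or a maximal path (a path with at least one edge, both ends of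 which have degree $1$ in that graph); split its edges alternately into $M_1,M_2$; let $\alpha>0$ be least such that adding $\alpha$ on $M_1$ and subtracting $\alpha$ on $M_2$ brings an edge of $M_1$ to $1$ or an edge of $M_2$ to $0$, and let $\beta>0$ be least such that subtracting $\beta$ on $M_1$ and adding $\beta$ on $M_2$ brings an edge of $M_1$ to $0$ or an edge of $M_2$ to $1$; with probability $\beta/(\alpha+\beta)$ make the first change (by $\alpha$), and otherwise, with probability $\alpha/(\alpha+\beta)$, the second (by $\beta$). The random choices are independent of each other and of which edges are active. 3. For each $v\in V_2$ in turn, probe the edges $e\in\delta(v)$ with $Y_e=1$ in decreasing order of weight until one of them is active (and hence matched) or none is left. **Theorem 4.1.** For every such instance, $\mathsf{LP}$ has an optimal solution, and for every optimal solution $y$ the algorithm can be carried out. However the choices left open are made (cycles and paths in step 2; the order of the vertices of $V_2$ and ties between weights in step 3), the algorithm is a probing algorithm, i.e. it always respects the matching and patience constraints; the expected total weight $\mathbb E[\mathsf{ALG}]$ that it matches satisfies $$\mathbb E[\mathsf{ALG}]\ \ge\ \Bigl(1-\frac1{\mathsf e}\Bigr)\sum_{v\in V_2}\sum_{e\in\delta(v)}w_ep_ey_e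 ;$$ and $\mathbb E[\mathsf{ALG}]$ is at least $(1-1/\mathsf e)$ times the expected weight matched by any probing algorithm on the same instance. That is, the algorithm is a $(1-1/\mathsf e)$-approximation. -/

import Mathlib

open scoped Classical

noncomputable section

/-- An instance of offline stochastic matching on the finite vertex set `V`: a graph, a
nonnegative weight `w e` and a probability `p e` of being active for each edge `e`, and a patience
`t v ∈ {0, 1, 2, …} ∪ {∞}` for each vertex `v`.  Values of `w` and `p` off the edge set are never
used. -/
structure StochasticGraph (V : Type*) where
  graph : SimpleGraph V
  w : Sym2 V → ℝ
  p : Sym2 V → ℝ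
  t : V → ℕ∞
  w_nonneg : ∀ e ∈ graph.edgeSet, 0 ≤ w e
  p_nonneg : ∀ e ∈ graph.edgeSet, 0 ≤ p e
  p_le_one : ∀ e ∈ graph.edgeSet, p e ≤ 1

/-- A randomized adaptive probing policy, as a finite decision tree: halt; or probe the edge `e`
and continue according to whether `e` turns out to be active (in which case it is matched) or
inactive; or flip a coin of bias `q`, independent of everything else, and continue with `heads`
(probability `q`) or with `tails` (probability `1 - q`). -/
inductive Policy (V : Type*) where
  | halt : Policy V
  | probe (e : Sym2 V) (ifActive ifInactive : Policy V) : Policy V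
  | coin (q : ℝ) (heads tails : Policy V) : Policy V

namespace StochasticGraph

variable {V : Type*} [Fintype V] (I : StochasticGraph V)

/-- The edge set `E`. -/
def edges : Finset (Sym2 V) := Finset.univ.filter (fun e => e ∈ I.graph.edgeSet)

/-- `δ(v)`: the edges incident to `v`. -/
def inc (v : V) : Finset (Sym2 V) := I.edges.filter (fun e => v ∈ e)

/-! ### The linear program -/

/-- Feasibility for the linear program, with `z e = y e * p e`.  A vertex of infinite patience has
no patience constraint. -/
structure LPFeasible (y : Sym2 V → ℝ) : Prop where
  matching : ∀ v, ∑ e ∈ I.inc v, y e * I.p e ≤ 1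
  patience : ∀ v, ∀ n : ℕ, I.t v = n → ∑ e ∈ I.inc v, y e ≤ n
  nonneg : ∀ e ∈ I.edges, 0 ≤ y e
  le_one : ∀ e ∈ I.edges, y e ≤ 1

/-- The objective `∑ w e * z e`. -/
def lpValue (y : Sym2 V → ℝ) : ℝ := ∑ e ∈ I.edges, I.w e * (y e * I.p e)

/-- `y` is an optimal solution of the linear program. -/
def LPOptimal (y : Sym2 V → ℝ) : Prop :=
  I.LPFeasible y ∧ ∀ y', I.LPFeasible y' → I.lpValue y' ≤ I.lpValue y

/-! ### Probing algorithms -/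

/-- When the edges in `B` have been probed and those in `M` have been matched, the edge `e` may be
probed: it has not been probed before, and both of its endpoints are unmatched and have remaining
patience. -/
def Safe (B M : Finset (Sym2 V)) (e : Sym2 V) : Prop :=
  e ∈ I.edges ∧ e ∉ B ∧
    ∀ v ∈ e, (∀ f ∈ M, v ∉ f) ∧ ((B.filter (fun f => v ∈ f)).card : ℕ∞) < I.t v

/-- Started when the edges in `B` have been probed and those in `M` have been matched, the policy
only ever probes safe edges. -/
def Admissible : Finset (Sym2 V) → Finset (Sym2 V) → Policy V → Prop
  | _, _, .halt => True
  | B, M, .probe e a b =>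
      I.Safe B M e ∧ Admissible (insert e B) (insert e M) a ∧ Admissible (insert e B) M b
  | B, M, .coin q a b => 0 ≤ q ∧ q ≤ 1 ∧ Admissible B M a ∧ Admissible B M b

/-- A probing algorithm for the instance: a policy that always respects the matching constraints
and the patience constraints. -/
def IsProbingAlgorithm (π : Policy V) : Prop := I.Admissible ∅ ∅ π

/-- The probability that `A` is the set of active edges; the edges are active independently, each
edge `e` with probability `p e`. -/
def activeProb (A : Finset (Sym2 V)) : ℝ :=
  (∏ e ∈ A, I.p e) * ∏ e ∈ I.edges \ A, (1 - I.p e)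

/-- The total weight of the edges matched by a policy when `A` is the set of active edges, in
expectation over the coins of the policy. -/
def weightOn (A : Finset (Sym2 V)) : Policy V → ℝ
  | .halt => 0
  | .probe e a b => if e ∈ A then I.w e + weightOn A a else weightOn A b
  | .coin q a b => q * weightOn A a + (1 - q) * weightOn A b

/-- The expected total weight of the edges matched by a policy. -/
def expectedWeight (π : Policy V) : ℝ :=
  ∑ A ∈ I.edges.powerset, I.activeProb A * I.weightOn A π

/-! ### Dependent rounding -/

/-- The graph of the floating edges, i.e. of the edges `e` with `0 < y e < 1`. -/
def floating (y : Sym2 V → ℝ) : SimpleGraph V :=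
  SimpleGraph.fromEdgeSet {e | e ∈ I.graph.edgeSet ∧ 0 < y e ∧ y e < 1}

/-- A walk to round along: a cycle of `H`, or a path of `H` with at least one edge that is maximal
in the sense that each of its two ends is on one edge of `H` only. -/
def IsRoundingWalk {H : SimpleGraph V} {a b : V} (P : H.Walk a b) : Prop :=
  (∃ h : a = b, (P.copy h rfl).IsCycle) ∨
    (P.IsPath ∧ 0 < P.length ∧ (∃! x, H.Adj a x) ∧ ∃! x, H.Adj b x)

/-- The first, third, fifth, … edges of a walk. -/
def altFst {H : SimpleGraph V} {a b : V} (P : H.Walk a b) : Set (Sym2 V) :=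
  {e | ∃ i, P.edges[2 * i]? = some e}

/-- The second, fourth, sixth, … edges of a walk. -/
def altSnd {H : SimpleGraph V} {a b : V} (P : H.Walk a b) : Set (Sym2 V) :=
  {e | ∃ i, P.edges[2 * i + 1]? = some e}

/-- Increase `y` by `γ` on `M₁` and decrease it by `γ` on `M₂`. -/
def shift (y : Sym2 V → ℝ) (M₁ M₂ : Set (Sym2 V)) (γ : ℝ) : Sym2 V → ℝ := fun e =>
  if e ∈ M₁ then y e + γ else if e ∈ M₂ then y e - γ else y e

/-- The positive amounts `γ` for which increasing `y` by `γ` on `M₁` and decreasing it by `γ` on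
`M₂` makes some edge of `M₁` reach `1` or some edge of `M₂` reach `0`. -/
def hits (y : Sym2 V → ℝ) (M₁ M₂ : Set (Sym2 V)) : Set ℝ :=
  {γ | 0 < γ ∧ ((∃ e ∈ M₁, y e + γ = 1) ∨ ∃ e ∈ M₂, y e - γ = 0)}

/-- One iteration of the dependent rounding procedure at `y`: choose a cycle or maximal path of
floating edges, and split it alternately into `M₁` and `M₂`.  Let `α` be the first amount at which
`y + α` on `M₁`, `y - α` on `M₂` makes one of these edges integral, and `β` the first amount at
which `y - β` on `M₁`, `y + β` on `M₂` does so.  Move to the former vector, `y₁`, with probability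
`q = β / (α + β)` and to the latter, `y₂`, with probability `1 - q = α / (α + β)`. -/
def RoundingStep (y : Sym2 V → ℝ) (q : ℝ) (y₁ y₂ : Sym2 V → ℝ) : Prop :=
  ∃ (a b : V) (P : (I.floating y).Walk a b) (α β : ℝ),
    IsRoundingWalk P ∧
    IsLeast (hits y (altFst P) (altSnd P)) α ∧
    IsLeast (hits y (altSnd P) (altFst P)) β ∧
    q = β / (α + β) ∧
    y₁ = shift y (altFst P) (altSnd P) α ∧
    y₂ = shift y (altSnd P) (altFst P) β

/-! ### The algorithm -/

/-- Probe the edges of a list in order until one of them is active (and is thus matched) or the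
list is exhausted; then continue with `next`. -/
def probeStar (next : Policy V) : List (Sym2 V) → Policy V
  | [] => next
  | e :: l => .probe e next (probeStar next l)

/-- Probe several stars, one after the other. -/
def probeStars : List (List (Sym2 V)) → Policy V
  | [] => .halt
  | s :: ss => probeStar (probeStars ss) s

/-- `π` treats the vertices `v ∈ V₂` one after the other (in some order), and for each of them
probes the edges `e ∈ δ(v)` with `Y e = 1` in decreasing order of weight (with ties broken in some
way) until one is matched. -/
def ProbesStars (V₂ : Finset V) (Y : Sym2 V → ℝ) (π : Policy V) : Prop :=
  ∃ (vs : List V) (star : V → List (Sym2 V)),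
    vs.Nodup ∧ (∀ v, v ∈ vs ↔ v ∈ V₂) ∧
    (∀ v ∈ V₂, (star v).Nodup ∧ (∀ e, e ∈ star v ↔ e ∈ I.inc v ∧ Y e = 1) ∧
      (star v).Pairwise (fun e f => I.w f ≤ I.w e)) ∧
    π = probeStars (vs.map star)

/-- `I.RoundThenProbe V₂ y π`: the policy `π` is the algorithm that rounds `y` by the dependent
rounding procedure and then probes the resulting stars, centred at the vertices of `V₂`, in
decreasing order of weight.  All choices that the procedure leaves open (the cycle or maximal path
used in an iteration, the order of the stars, the order among edges of equal weight) are arbitrary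
and may depend on the history. -/
inductive RoundThenProbe (V₂ : Finset V) : (Sym2 V → ℝ) → Policy V → Prop
  | probe (Y : Sym2 V → ℝ) (π : Policy V) (integral : ∀ e ∈ I.edges, Y e = 0 ∨ Y e = 1)
      (stars : I.ProbesStars V₂ Y π) : RoundThenProbe V₂ Y π
  | round (y y₁ y₂ : Sym2 V → ℝ) (q : ℝ) (π₁ π₂ : Policy V) (step : I.RoundingStep y q y₁ y₂)
      (run₁ : RoundThenProbe V₂ y₁ π₁) (run₂ : RoundThenProbe V₂ y₂ π₂) :
      RoundThenProbe V₂ y (.coin q π₁ π₂)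

end StochasticGraph

end

/-!
Dependent rounding has two features that carry the theorem.  A cycle or maximal path of the
bipartite floating graph meets each vertex in one edge of each of its two halves, except that the
end of a path is a leaf (`IsRoundingWalk.alternate`).  Hence a rounding step leaves the fractional
degree of every vertex alone, except where only one edge is floating, and so it never violates an
integral degree bound (`RoundingStep.patienceFeasible`): the selected edges respect all patiences.
As the vertices of `V₁` have patience one, the stars selected at the vertices of `V₂` are disjoint
and do not interfere with each other.

Secondly, a step moves at most two edges of a vertex, in opposite directions and by an amount of
mean zero.  So `∏ (1 - p e * y e)`, over any edges at that vertex, does not increase in expectation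
(`RoundingStep.expected_prod_le`); at the end it is the conditional probability that none of the
selected ones among these edges is active.  The expected weight of a star that is probed in
decreasing order of weight is a nonnegative combination of the complementary probabilities, over the
initial segments of the order (`exists_layers`).  Hence `vertexValue`, which interpolates this
weight multilinearly at fractional `y`, is a submartingale (`RoundThenProbe.analysis`, an induction
over the run of the algorithm, whatever its choices).  For the initial `y`, each term is at least
`1 - exp (-x) ≥ (1 - 1 / e) * x` with `x = ∑ p e * y e ≤ 1` over the initial segment, and reversing
the summation by parts gives the bound at each vertex (`LPFeasible.le_vertexValue`).

Finally, the probabilities with which a probing algorithm probes the edges are feasible for the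
linear program, with the expected weight of the algorithm as objective value
(`IsProbingAlgorithm.lpFeasible`, `Admissible.treeValue_eq`).  As no edge is probed twice, the
expectation over the active edges may be computed by recursion on the decision tree
(`IsProbingAlgorithm.expectedWeight_eq`).
-/

noncomputable section

namespace StochasticGraph

/-! ### Cycles and maximal paths -/

/-- Two disjoint sets of edges of `H` that alternate: each vertex is on at most one edge of each,
and a vertex that is on an edge of only one of them has degree one in `H`.  This is all that the
analysis of dependent rounding needs to know about the two halves of a cycle or maximal path. -/
structure Alternate {V : Type*} (H : SimpleGraph V) (M₁ M₂ : Set (Sym2 V)) : Prop where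
  disjoint : ∀ e ∈ M₁, e ∉ M₂
  nonempty : ∃ e, e ∈ M₁ ∨ e ∈ M₂
  fst_mem : ∀ e ∈ M₁, e ∈ H.edgeSet
  snd_mem : ∀ e ∈ M₂, e ∈ H.edgeSet
  fst_unique : ∀ v, ∀ e ∈ M₁, ∀ f ∈ M₁, v ∈ e → v ∈ f → e = f
  snd_unique : ∀ v, ∀ e ∈ M₂, ∀ f ∈ M₂, v ∈ e → v ∈ f → e = f
  fst_balanced : ∀ v, ∀ e ∈ M₁, v ∈ e → (∃ f ∈ M₂, v ∈ f) ∨ ∃! x, H.Adj v x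
  snd_balanced : ∀ v, ∀ e ∈ M₂, v ∈ e → (∃ f ∈ M₁, v ∈ f) ∨ ∃! x, H.Adj v x

section Walks

variable {V : Type*} {H : SimpleGraph V}

theorem Alternate.symm {M₁ M₂ : Set (Sym2 V)} (h : Alternate H M₁ M₂) : Alternate H M₂ M₁ where
  disjoint e h₂ h₁ := h.disjoint e h₁ h₂
  nonempty := h.nonempty.imp fun _ => Or.symm
  fst_mem := h.snd_mem
  snd_mem := h.fst_mem
  fst_unique := h.snd_unique
  snd_unique := h.fst_unique
  fst_balanced := h.snd_balanced
  snd_balanced := h.fst_balanced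

theorem edges_getElem?_eq_some_iff {a b : V} (P : H.Walk a b) (i : ℕ) (e : Sym2 V) :
    P.edges[i]? = some e ↔ i < P.length ∧ e = s(P.getVert i, P.getVert (i + 1)) := by
  constructor
  · intro h
    obtain ⟨hi, rfl⟩ := List.getElem?_eq_some_iff.1 h
    exact ⟨by simpa using hi, P.getElem_edges hi⟩
  · rintro ⟨hi, rfl⟩
    exact List.getElem?_eq_some_iff.2 ⟨by simpa using hi, P.getElem_edges _⟩

/-- Along a walk in a bipartite graph, the side of the bipartition changes at each step. -/
theorem getVert_mem_side_iff {V₁ V₂ : Set V} (hH : H.IsBipartiteWith V₁ V₂) {a b : V}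
    (P : H.Walk a b) (i : ℕ) (hi : i ≤ P.length) :
    P.getVert i ∈ V₁ ↔ (a ∈ V₁ ↔ Even i) := by
  induction i with
  | zero => simp
  | succ i ih =>
    have hadj := P.adj_getVert_succ (i := i) (by omega)
    have hd := Set.disjoint_left.1 hH.disjoint
    have hstep : P.getVert (i + 1) ∈ V₁ ↔ P.getVert i ∉ V₁ := by
      rcases hH.mem_of_adj hadj with ⟨h₁, h₂⟩ | ⟨h₁, h₂⟩
      · simp only [h₁, not_true, iff_false]
        exact fun h => hd h h₂
      · simp only [h₂, true_iff]
        exact fun h => hd h h₁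
    rw [hstep, ih (by omega), Nat.even_add_one]
    tauto

theorem IsRoundingWalk.length_pos {a b : V} {P : H.Walk a b} (hP : IsRoundingWalk P) :
    0 < P.length := by
  rcases hP with ⟨rfl, h⟩ | h
  · have := h.three_le_length
    simp only [SimpleGraph.Walk.copy_rfl_rfl] at this
    omega
  · exact h.2.1

theorem IsRoundingWalk.isTrail {a b : V} {P : H.Walk a b} (hP : IsRoundingWalk P) :
    P.IsTrail := by
  rcases hP with ⟨rfl, h⟩ | h
  · simpa only [SimpleGraph.Walk.copy_rfl_rfl] using h.isTrail
  · exact h.1.isTrail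

theorem IsRoundingWalk.getVert_inj {a b : V} {P : H.Walk a b} (hP : IsRoundingWalk P) {i j : ℕ}
    (hi : i < P.length) (hj : j < P.length) (h : P.getVert i = P.getVert j) : i = j := by
  rcases hP with ⟨rfl, hc⟩ | hp
  · simp only [SimpleGraph.Walk.copy_rfl_rfl] at hc
    exact hc.getVert_injOn' (by simp only [Set.mem_ofPred_eq]; omega)
      (by simp only [Set.mem_ofPred_eq]; omega) h
  · exact hp.1.getVert_injOn (by simp only [Set.mem_ofPred_eq]; omega)
      (by simp only [Set.mem_ofPred_eq]; omega) h

theorem IsRoundingWalk.getVert_succ_inj {a b : V} {P : H.Walk a b} (hP : IsRoundingWalk P)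
    {i j : ℕ} (hi : i < P.length) (hj : j < P.length)
    (h : P.getVert (i + 1) = P.getVert (j + 1)) : i = j := by
  rcases hP with ⟨rfl, hc⟩ | hp
  · simp only [SimpleGraph.Walk.copy_rfl_rfl] at hc
    have := hc.getVert_injOn (x₁ := i + 1) (x₂ := j + 1) (by simp only [Set.mem_ofPred_eq]; omega)
      (by simp only [Set.mem_ofPred_eq]; omega) h
    omega
  · have := hp.1.getVert_injOn (x₁ := i + 1) (x₂ := j + 1) (by simp only [Set.mem_ofPred_eq]; omega)
      (by simp only [Set.mem_ofPred_eq]; omega) h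
    omega

/-- Two edges of a rounding walk in a bipartite graph whose indices have the same parity and which
share a vertex are equal: the walk traverses both of them from the same side of the bipartition, so
that the common vertex is the first vertex of both or the last vertex of both. -/
theorem IsRoundingWalk.eq_of_mem {V₁ V₂ : Set V} (hH : H.IsBipartiteWith V₁ V₂) {a b : V}
    {P : H.Walk a b} (hP : IsRoundingWalk P) {i j : ℕ} (hi : i < P.length) (hj : j < P.length)
    (hij : Even i ↔ Even j) {v : V} (hvi : v ∈ s(P.getVert i, P.getVert (i + 1)))
    (hvj : v ∈ s(P.getVert j, P.getVert (j + 1))) : i = j := by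
  have h₁ := getVert_mem_side_iff hH P i hi.le
  have h₂ := getVert_mem_side_iff hH P (i + 1) hi
  have h₃ := getVert_mem_side_iff hH P j hj.le
  have h₄ := getVert_mem_side_iff hH P (j + 1) hj
  rw [Nat.even_add_one] at h₂ h₄
  rw [hij] at h₁ h₂
  have hne : ¬ ((a ∈ V₁ ↔ Even j) ↔ (a ∈ V₁ ↔ ¬ Even j)) := by
    clear h₁ h₂ h₃ h₄ hij
    tauto
  rcases Sym2.mem_iff.1 hvi with rfl | rfl <;> rcases Sym2.mem_iff.1 hvj with h | h
  · exact hP.getVert_inj hi hj h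
  · rw [h] at h₁
    exact (hne (h₁.symm.trans h₄)).elim
  · rw [h] at h₂
    exact (hne (h₃.symm.trans h₂)).elim
  · exact hP.getVert_succ_inj hi hj h

/-- A vertex on the `i`-th edge of a rounding walk in a bipartite graph is on an edge whose index
has the other parity, unless it has degree one. -/
theorem IsRoundingWalk.exists_neighbour_edge {V₁ V₂ : Set V} (hH : H.IsBipartiteWith V₁ V₂)
    {a b : V} {P : H.Walk a b} (hP : IsRoundingWalk P) {i : ℕ} (hi : i < P.length) {v : V}
    (hv : v ∈ s(P.getVert i, P.getVert (i + 1))) :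
    (∃ j < P.length, (Even j ↔ ¬ Even i) ∧ v ∈ s(P.getVert j, P.getVert (j + 1))) ∨
      ∃! x, H.Adj v x := by
  rcases Sym2.mem_iff.1 hv with rfl | rfl
  · rcases Nat.eq_zero_or_pos i with rfl | hpos
    · -- at the start of the walk: the last edge of a cycle, or a leaf
      rcases hP with ⟨rfl, hc⟩ | hp
      · left
        simp only [SimpleGraph.Walk.copy_rfl_rfl] at hc
        have hlen := getVert_mem_side_iff hH P P.length le_rfl
        rw [P.getVert_length] at hlen
        obtain ⟨k, hk⟩ : ∃ k, P.length = k + 1 := ⟨P.length - 1, by omega⟩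
        refine ⟨k, by omega, ?_, ?_⟩
        · rw [hk, Nat.even_add_one] at hlen
          simp only [Nat.even_iff] at *
          tauto
        · rw [← hk, P.getVert_length, P.getVert_zero]
          exact Sym2.mem_mk_right _ _
      · right
        rw [P.getVert_zero]
        exact hp.2.2.1
    · left
      obtain ⟨k, rfl⟩ : ∃ k, i = k + 1 := ⟨i - 1, by omega⟩
      refine ⟨k, by omega, ?_, Sym2.mem_mk_right _ _⟩
      rw [Nat.even_add_one, not_not]
  · rcases Nat.lt_or_ge (i + 1) P.length with hlt | hge
    · exact Or.inl ⟨i + 1, hlt, Nat.even_add_one, Sym2.mem_mk_left _ _⟩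
    · -- at the end of the walk: the first edge of a cycle, or a leaf
      have hlast : i + 1 = P.length := by omega
      rw [hlast, P.getVert_length]
      rcases hP with ⟨rfl, hc⟩ | hp
      · left
        have hlen := getVert_mem_side_iff hH P P.length le_rfl
        rw [P.getVert_length, ← hlast, Nat.even_add_one] at hlen
        refine ⟨0, by omega, ?_, ?_⟩
        · simp only [Even.zero, true_iff]
          tauto
        · rw [P.getVert_zero]
          exact Sym2.mem_mk_left _ _
      · exact Or.inr hp.2.2.2

theorem mem_altFst_iff {a b : V} (P : H.Walk a b) (e : Sym2 V) :
    e ∈ altFst P ↔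
      ∃ i < P.length, Even i ∧ e = s(P.getVert i, P.getVert (i + 1)) := by
  simp only [altFst, Set.mem_ofPred_eq, edges_getElem?_eq_some_iff]
  constructor
  · rintro ⟨i, hi, he⟩
    exact ⟨2 * i, hi, even_two_mul i, he⟩
  · rintro ⟨i, hi, hev, he⟩
    obtain ⟨k, rfl⟩ := even_iff_exists_two_mul.1 hev
    exact ⟨k, hi, he⟩

theorem mem_altSnd_iff {a b : V} (P : H.Walk a b) (e : Sym2 V) :
    e ∈ altSnd P ↔
      ∃ i < P.length, ¬ Even i ∧ e = s(P.getVert i, P.getVert (i + 1)) := by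
  simp only [altSnd, Set.mem_ofPred_eq, edges_getElem?_eq_some_iff, Nat.not_even_iff_odd]
  constructor
  · rintro ⟨i, hi, he⟩
    exact ⟨2 * i + 1, hi, odd_two_mul_add_one i, he⟩
  · rintro ⟨i, hi, ⟨k, rfl⟩, he⟩
    exact ⟨k, hi, he⟩

theorem IsRoundingWalk.alternate {V₁ V₂ : Set V} (hH : H.IsBipartiteWith V₁ V₂) {a b : V}
    {P : H.Walk a b} (hP : IsRoundingWalk P) : Alternate H (altFst P) (altSnd P) where
  disjoint e h₁ h₂ := by
    obtain ⟨i, hi⟩ := h₁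
    obtain ⟨j, hj⟩ := h₂
    have hlt := (List.getElem?_eq_some_iff.1 hi).1
    have := (List.getElem?_inj hlt hP.isTrail.edges_nodup).1 (hi.trans hj.symm)
    omega
  nonempty := ⟨_, Or.inl ((mem_altFst_iff P _).2 ⟨0, hP.length_pos, Even.zero, rfl⟩)⟩
  fst_mem e h := by
    obtain ⟨i, hi, -, rfl⟩ := (mem_altFst_iff P e).1 h
    exact P.adj_getVert_succ hi
  snd_mem e h := by
    obtain ⟨i, hi, -, rfl⟩ := (mem_altSnd_iff P e).1 h
    exact P.adj_getVert_succ hi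
  fst_unique v e he f hf hve hvf := by
    obtain ⟨i, hi, hi2, rfl⟩ := (mem_altFst_iff P e).1 he
    obtain ⟨j, hj, hj2, rfl⟩ := (mem_altFst_iff P f).1 hf
    rw [hP.eq_of_mem hH hi hj (by tauto) hve hvf]
  snd_unique v e he f hf hve hvf := by
    obtain ⟨i, hi, hi2, rfl⟩ := (mem_altSnd_iff P e).1 he
    obtain ⟨j, hj, hj2, rfl⟩ := (mem_altSnd_iff P f).1 hf
    rw [hP.eq_of_mem hH hi hj (by tauto) hve hvf]
  fst_balanced v e he hve := by
    obtain ⟨i, hi, hi2, rfl⟩ := (mem_altFst_iff P e).1 he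
    refine (hP.exists_neighbour_edge hH hi hve).imp_left ?_
    rintro ⟨j, hj, hij, hvj⟩
    exact ⟨_, (mem_altSnd_iff P _).2 ⟨j, hj, by tauto, rfl⟩, hvj⟩
  snd_balanced v e he hve := by
    obtain ⟨i, hi, hi2, rfl⟩ := (mem_altSnd_iff P e).1 he
    refine (hP.exists_neighbour_edge hH hi hve).imp_left ?_
    rintro ⟨j, hj, hij, hvj⟩
    exact ⟨_, (mem_altFst_iff P _).2 ⟨j, hj, by tauto, rfl⟩, hvj⟩

/-- A finite graph with an edge contains a cycle or, if it is a forest, a longest path, whose ends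
then are leaves. -/
theorem exists_isRoundingWalk [Finite V] {e : Sym2 V} (he : e ∈ H.edgeSet) :
    ∃ (a b : V) (P : H.Walk a b), IsRoundingWalk P := by
  induction e with | _ x y => ?_
  have hxy : H.Adj x y := he
  by_cases hac : H.IsAcyclic
  · have : Nonempty V := ⟨x⟩
    obtain ⟨a, b, P, hp, hmax⟩ := SimpleGraph.Walk.exists_isPath_forall_isPath_length_le_length H
    have hlen : 0 < P.length := by
      have := hmax x y hxy.toWalk (by simp [hxy.ne])
      simp at this
      omega
    have hnil : ¬ P.Nil := by
      rw [← SimpleGraph.Walk.length_eq_zero_iff]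
      omega
    refine ⟨a, b, P, Or.inr ⟨hp, hlen, ⟨_, P.adj_snd hnil, fun w hadj => ?_⟩,
      ⟨_, (P.adj_penultimate hnil).symm, fun w hadj => ?_⟩⟩⟩
    · apply hac.eq_snd_of_adj_start hp hadj
      by_contra hw
      have := hmax _ _ (P.cons hadj.symm) (hp.cons hw)
      simp at this
    · apply hac.eq_penultimate_of_adj_end hp hadj
      by_contra hw
      have := hmax _ _ (P.concat hadj) (hp.concat hw hadj)
      simp at this
  · simp only [SimpleGraph.IsAcyclic, not_forall, not_not] at hac
    obtain ⟨v, c, hc⟩ := hac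
    exact ⟨v, v, c, Or.inl ⟨rfl, hc⟩⟩

end Walks

/-! ### One rounding step -/

section Shift

variable {V : Type*}

theorem shift_fst {y : Sym2 V → ℝ} {M₁ M₂ : Set (Sym2 V)} {e : Sym2 V} (he : e ∈ M₁) (γ : ℝ) :
    shift y M₁ M₂ γ e = y e + γ := by
  simp [shift, he]

theorem shift_of_notMem {y : Sym2 V → ℝ} {M₁ M₂ : Set (Sym2 V)} {e : Sym2 V} (h₁ : e ∉ M₁)
    (h₂ : e ∉ M₂) (γ : ℝ) : shift y M₁ M₂ γ e = y e := by
  simp [shift, h₁, h₂]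

theorem Alternate.shift_snd {H : SimpleGraph V} {y : Sym2 V → ℝ} {M₁ M₂ : Set (Sym2 V)}
    (hM : Alternate H M₁ M₂) {e : Sym2 V} (he : e ∈ M₂) (γ : ℝ) :
    shift y M₁ M₂ γ e = y e - γ := by
  have : e ∉ M₁ := fun h => hM.disjoint e h he
  simp [shift, he, this]

theorem Alternate.shift_swap {H : SimpleGraph V} {y : Sym2 V → ℝ} {M₁ M₂ : Set (Sym2 V)}
    (hM : Alternate H M₁ M₂) (γ : ℝ) : shift y M₂ M₁ γ = shift y M₁ M₂ (-γ) := by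
  funext e
  by_cases h₁ : e ∈ M₁
  · rw [shift_fst h₁, hM.symm.shift_snd h₁]
    ring
  · by_cases h₂ : e ∈ M₂
    · rw [shift_fst h₂, hM.shift_snd h₂]
      ring
    · rw [shift_of_notMem h₁ h₂, shift_of_notMem h₂ h₁]

theorem exists_prod_eq_affine (T : Finset (Sym2 V)) (hT : ∀ e ∈ T, ∀ f ∈ T, e = f)
    (p y : Sym2 V → ℝ) (hp : ∀ e ∈ T, 0 ≤ p e) :
    ∃ A a : ℝ, 0 ≤ a ∧ ∀ γ, ∏ e ∈ T, (1 - p e * (y e + γ)) = A - a * γ := by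
  rcases T.eq_empty_or_nonempty with rfl | ⟨e, he⟩
  · exact ⟨1, 0, le_rfl, fun γ => by simp⟩
  · have : T = {e} := Finset.eq_singleton_iff_unique_mem.2 ⟨he, fun f hf => hT f hf e he⟩
    subst this
    refine ⟨1 - p e * y e, p e, hp e he, fun γ => ?_⟩
    rw [Finset.prod_singleton]
    ring

theorem RoundingStep.prob_mem_Icc {I : StochasticGraph V} {y y₁ y₂ : Sym2 V → ℝ} {q : ℝ}
    (h : I.RoundingStep y q y₁ y₂) : 0 ≤ q ∧ q ≤ 1 := by
  obtain ⟨a, b, P, α, β, -, hα, hβ, rfl, -⟩ := h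
  have := hα.1.1
  have := hβ.1.1
  exact ⟨by positivity, by rw [div_le_one (by positivity)]; linarith⟩

end Shift

section Rounding

variable {V : Type*} [Fintype V] (I : StochasticGraph V)

theorem mem_edges_iff {e : Sym2 V} : e ∈ I.edges ↔ e ∈ I.graph.edgeSet := by
  simp [edges]

theorem mem_inc_iff {v : V} {e : Sym2 V} : e ∈ I.inc v ↔ e ∈ I.edges ∧ v ∈ e := by
  simp [inc]

theorem mem_floating_iff {y : Sym2 V → ℝ} {e : Sym2 V} :
    e ∈ (I.floating y).edgeSet ↔ e ∈ I.edges ∧ 0 < y e ∧ y e < 1 := by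
  rw [floating, SimpleGraph.edgeSet_fromEdgeSet, mem_edges_iff]
  constructor
  · exact fun h => h.1
  · exact fun h => ⟨h, I.graph.not_isDiag_of_mem_edgeSet h.1⟩

theorem floating_le (y : Sym2 V → ℝ) : I.floating y ≤ I.graph := by
  rw [← SimpleGraph.edgeSet_subset_edgeSet]
  exact fun e he => I.mem_edges_iff.1 (I.mem_floating_iff.1 he).1

/-- The constraints of the linear program that dependent rounding preserves: all of them but the
matching constraints. -/
structure PatienceFeasible (y : Sym2 V → ℝ) : Prop where
  patience : ∀ v, ∀ n : ℕ, I.t v = n → ∑ e ∈ I.inc v, y e ≤ n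
  nonneg : ∀ e ∈ I.edges, 0 ≤ y e
  le_one : ∀ e ∈ I.edges, y e ≤ 1

variable {I}

theorem LPFeasible.patienceFeasible {y : Sym2 V → ℝ} (h : I.LPFeasible y) :
    I.PatienceFeasible y :=
  ⟨h.patience, h.nonneg, h.le_one⟩

section Step

variable {y : Sym2 V → ℝ} {M₁ M₂ : Set (Sym2 V)} (hM : Alternate (I.floating y) M₁ M₂)
include hM

theorem Alternate.exists_isLeast_hits : ∃ α, IsLeast (hits y M₁ M₂) α := by
  have hfin : (hits y M₁ M₂).Finite := by
    refine ((Set.finite_range fun e => 1 - y e).union (Set.finite_range y)).subset ?_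
    rintro γ ⟨-, ⟨e, -, he⟩ | ⟨e, -, he⟩⟩
    · exact Or.inl ⟨e, by simp only; linarith⟩
    · exact Or.inr ⟨e, by linarith⟩
  have hne : (hits y M₁ M₂).Nonempty := by
    obtain ⟨e, he | he⟩ := hM.nonempty
    · have := (I.mem_floating_iff.1 (hM.fst_mem e he)).2.2
      exact ⟨1 - y e, by linarith, Or.inl ⟨e, he, by ring⟩⟩
    · have := (I.mem_floating_iff.1 (hM.snd_mem e he)).2.1
      exact ⟨y e, this, Or.inr ⟨e, he, by ring⟩⟩
  obtain ⟨α, hα, hmin⟩ := Set.exists_min_image _ id hfin hne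
  exact ⟨α, hα, fun γ hγ => hmin γ hγ⟩

variable {α : ℝ} (hα : IsLeast (hits y M₁ M₂) α)
include hα

theorem Alternate.shift_bounds (h0 : ∀ e ∈ I.edges, 0 ≤ y e) (h1 : ∀ e ∈ I.edges, y e ≤ 1)
    {e : Sym2 V} (he : e ∈ I.edges) :
    0 ≤ shift y M₁ M₂ α e ∧ shift y M₁ M₂ α e ≤ 1 := by
  have hpos := hα.1.1
  by_cases h₁ : e ∈ M₁
  · have hf := (I.mem_floating_iff.1 (hM.fst_mem e h₁)).2
    have := hα.2 (show 1 - y e ∈ hits y M₁ M₂ from ⟨by linarith, Or.inl ⟨e, h₁, by ring⟩⟩)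
    rw [shift_fst h₁]
    constructor <;> linarith
  · by_cases h₂ : e ∈ M₂
    · have hf := (I.mem_floating_iff.1 (hM.snd_mem e h₂)).2
      have := hα.2 (show y e ∈ hits y M₁ M₂ from ⟨hf.1, Or.inr ⟨e, h₂, by ring⟩⟩)
      rw [hM.shift_snd h₂]
      constructor <;> linarith
    · rw [shift_of_notMem h₁ h₂]
      exact ⟨h0 e he, h1 e he⟩

/-- A step makes at least one edge integral, and leaves integral edges alone. -/
theorem Alternate.card_floating_shift_lt :
    (I.edges.filter fun e => 0 < shift y M₁ M₂ α e ∧ shift y M₁ M₂ α e < 1).card <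
      (I.edges.filter fun e => 0 < y e ∧ y e < 1).card := by
  refine Finset.card_lt_card ((Finset.ssubset_iff_of_subset fun e => ?_).2 ?_)
  · simp only [Finset.mem_filter]
    rintro ⟨he, hlt⟩
    by_cases h₁ : e ∈ M₁
    · exact I.mem_floating_iff.1 (hM.fst_mem e h₁)
    by_cases h₂ : e ∈ M₂
    · exact I.mem_floating_iff.1 (hM.snd_mem e h₂)
    rw [shift_of_notMem h₁ h₂] at hlt
    exact ⟨he, hlt⟩
  · rcases hα.1.2 with ⟨e, he, heq⟩ | ⟨e, he, heq⟩
    · refine ⟨e, Finset.mem_filter.2 (I.mem_floating_iff.1 (hM.fst_mem e he)), fun h => ?_⟩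
      have := (Finset.mem_filter.1 h).2.2
      rw [shift_fst he] at this
      linarith
    · refine ⟨e, Finset.mem_filter.2 (I.mem_floating_iff.1 (hM.snd_mem e he)), fun h => ?_⟩
      have := (Finset.mem_filter.1 h).2.1
      rw [hM.shift_snd he] at this
      linarith

end Step

/-- A sum of zeros and ones is a natural number. -/
theorem exists_nat_sum_eq {ι : Type*} (s : Finset ι) (y : ι → ℝ) (h : ∀ i ∈ s, y i = 0 ∨ y i = 1) :
    ∃ k : ℕ, ∑ i ∈ s, y i = k := by
  refine ⟨(s.filter fun i => y i = 1).card, ?_⟩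
  rw [Finset.card_filter, Nat.cast_sum]
  refine Finset.sum_congr rfl fun i hi => ?_
  rcases h i hi with h | h <;> simp [h]

/-- If only the edge `f` at `v` is floating, then raising it to at most `1` respects an integral
degree bound at `v`. -/
theorem sum_inc_le_of_unique_floating {y y' : Sym2 V → ℝ} {v : V} {f : Sym2 V} {n : ℕ}
    (hf : f ∈ I.inc v) (hpos : 0 < y f) (hf1 : y' f ≤ 1)
    (hint : ∀ e ∈ I.inc v, e ≠ f → y e = 0 ∨ y e = 1)
    (heq : ∀ e ∈ I.inc v, e ≠ f → y' e = y e) (hn : ∑ e ∈ I.inc v, y e ≤ n) :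
    ∑ e ∈ I.inc v, y' e ≤ n := by
  rw [← Finset.add_sum_erase _ _ hf] at hn ⊢
  obtain ⟨k, hk⟩ := exists_nat_sum_eq ((I.inc v).erase f) y fun e he =>
    hint e (Finset.mem_of_mem_erase he) (Finset.ne_of_mem_erase he)
  rw [Finset.sum_congr rfl fun e he =>
    heq e (Finset.mem_of_mem_erase he) (Finset.ne_of_mem_erase he), hk]
  rw [hk] at hn
  have hlt : (k : ℝ) < n := by linarith
  have : k + 1 ≤ n := by exact_mod_cast hlt
  have : (k : ℝ) + 1 ≤ n := by exact_mod_cast this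
  linarith

theorem Alternate.sum_inc_shift {y : Sym2 V → ℝ} {M₁ M₂ : Set (Sym2 V)}
    (hM : Alternate (I.floating y) M₁ M₂) (γ : ℝ) {v : V} {e₁ e₂ : Sym2 V} (he₁ : e₁ ∈ M₁)
    (he₂ : e₂ ∈ M₂) (hv₁ : v ∈ e₁) (hv₂ : v ∈ e₂) :
    ∑ e ∈ I.inc v, shift y M₁ M₂ γ e = ∑ e ∈ I.inc v, y e := by
  have h₁ : e₁ ∈ I.inc v := I.mem_inc_iff.2 ⟨(I.mem_floating_iff.1 (hM.fst_mem _ he₁)).1, hv₁⟩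
  have h₂ : e₂ ∈ I.inc v := I.mem_inc_iff.2 ⟨(I.mem_floating_iff.1 (hM.snd_mem _ he₂)).1, hv₂⟩
  have hne : e₂ ≠ e₁ := by
    rintro rfl
    exact hM.disjoint _ he₁ he₂
  have h₂' : e₂ ∈ (I.inc v).erase e₁ := Finset.mem_erase.2 ⟨hne, h₂⟩
  rw [← Finset.add_sum_erase _ _ h₁, ← Finset.add_sum_erase _ _ h₂',
    ← Finset.add_sum_erase _ y h₁, ← Finset.add_sum_erase _ y h₂', shift_fst he₁,
    hM.shift_snd he₂, Finset.sum_congr rfl fun e he => ?_]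
  · ring
  · simp only [Finset.mem_erase] at he
    obtain ⟨hne₂, hne₁, he⟩ := he
    have hve := (I.mem_inc_iff.1 he).2
    exact shift_of_notMem (fun h => hne₁ (hM.fst_unique v _ h _ he₁ hve hv₁))
      (fun h => hne₂ (hM.snd_unique v _ h _ he₂ hve hv₂)) γ

theorem Alternate.patienceFeasible_shift {y : Sym2 V → ℝ} {M₁ M₂ : Set (Sym2 V)}
    (hM : Alternate (I.floating y) M₁ M₂) {α : ℝ} (hα : IsLeast (hits y M₁ M₂) α)
    (hy : I.PatienceFeasible y) : I.PatienceFeasible (shift y M₁ M₂ α) := by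
  have hb := fun e he => hM.shift_bounds hα hy.nonneg hy.le_one (e := e) he
  refine ⟨fun v n hn => ?_, fun e he => (hb e he).1, fun e he => (hb e he).2⟩
  have hsum := hy.patience v n hn
  -- a vertex at which only one half of the walk has an edge is a leaf of the floating graph
  have leaf : ∀ f : Sym2 V, f ∈ (I.floating y).edgeSet → v ∈ f →
      (∃! x, (I.floating y).Adj v x) → ∑ e ∈ I.inc v, shift y M₁ M₂ α e ≤ n := by
    rintro f hf hvf ⟨x, hx, huniq⟩
    have hfl : ∀ e ∈ (I.floating y).edgeSet, v ∈ e → e = s(v, x) := by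
      intro e he hve
      obtain ⟨z, rfl⟩ := Sym2.mem_iff_exists.1 hve
      rw [huniq z he]
    have hff := I.mem_floating_iff.1 hf
    have hnot : ∀ e ∈ I.inc v, e ≠ f → e ∉ (I.floating y).edgeSet := fun e he hne h =>
      hne ((hfl e h (I.mem_inc_iff.1 he).2).trans (hfl f hf hvf).symm)
    refine sum_inc_le_of_unique_floating (I.mem_inc_iff.2 ⟨hff.1, hvf⟩) hff.2.1 (hb f hff.1).2
      (fun e he hne => ?_) (fun e he hne => ?_) hsum
    · have he' := (I.mem_inc_iff.1 he).1
      have := hnot e he hne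
      rw [I.mem_floating_iff] at this
      by_contra hcon
      push Not at hcon
      exact this ⟨he', lt_of_le_of_ne (hy.nonneg e he') hcon.1.symm,
        lt_of_le_of_ne (hy.le_one e he') hcon.2⟩
    · exact shift_of_notMem (fun h => hnot e he hne (hM.fst_mem e h))
        (fun h => hnot e he hne (hM.snd_mem e h)) α
  by_cases h₁ : ∃ e ∈ M₁, v ∈ e
  · obtain ⟨e₁, he₁, hv₁⟩ := h₁
    rcases hM.fst_balanced v e₁ he₁ hv₁ with ⟨e₂, he₂, hv₂⟩ | h
    · rwa [hM.sum_inc_shift α he₁ he₂ hv₁ hv₂]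
    · exact leaf e₁ (hM.fst_mem _ he₁) hv₁ h
  · by_cases h₂ : ∃ e ∈ M₂, v ∈ e
    · obtain ⟨e₂, he₂, hv₂⟩ := h₂
      rcases hM.snd_balanced v e₂ he₂ hv₂ with h | h
      · exact (h₁ h).elim
      · exact leaf e₂ (hM.snd_mem _ he₂) hv₂ h
    · rwa [Finset.sum_congr rfl fun e he => shift_of_notMem
        (fun h => h₁ ⟨e, h, (I.mem_inc_iff.1 he).2⟩)
        (fun h => h₂ ⟨e, h, (I.mem_inc_iff.1 he).2⟩) α]

/-- The negative correlation behind dependent rounding.  A step changes at most two of the edges at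
a vertex `v`, in opposite directions, so that `∏ (1 - p e * y e)`, over any of the edges at `v`, is
a concave function of the amount of the shift; and the expected amount is `0`. -/
theorem Alternate.expected_prod_le {y : Sym2 V → ℝ} {M₁ M₂ : Set (Sym2 V)}
    (hM : Alternate (I.floating y) M₁ M₂) {v : V} {S : Finset (Sym2 V)} (hS : S ⊆ I.inc v)
    (h0 : ∀ e ∈ I.edges, 0 ≤ y e) (h1 : ∀ e ∈ I.edges, y e ≤ 1) {α β : ℝ} (hα : 0 < α)
    (hβ : 0 < β) :
    β / (α + β) * ∏ e ∈ S, (1 - I.p e * shift y M₁ M₂ α e) +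
        (1 - β / (α + β)) * ∏ e ∈ S, (1 - I.p e * shift y M₂ M₁ β e) ≤
      ∏ e ∈ S, (1 - I.p e * y e) := by
  have hSE : ∀ e ∈ S, e ∈ I.edges := fun e he => (I.mem_inc_iff.1 (hS he)).1
  have hSv : ∀ e ∈ S, v ∈ e := fun e he => (I.mem_inc_iff.1 (hS he)).2
  have hp : ∀ e ∈ S, 0 ≤ I.p e := fun e he => I.p_nonneg e (I.mem_edges_iff.1 (hSE e he))
  obtain ⟨A, a, ha, hA⟩ := exists_prod_eq_affine (S.filter (· ∈ M₁)) (fun e he f hf => by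
    simp only [Finset.mem_filter] at he hf
    exact hM.fst_unique v e he.2 f hf.2 (hSv e he.1) (hSv f hf.1)) I.p y
    fun e he => hp e (Finset.mem_filter.1 he).1
  obtain ⟨B, b, hb, hB⟩ := exists_prod_eq_affine ((S.filter (· ∉ M₁)).filter (· ∈ M₂))
    (fun e he f hf => by
      simp only [Finset.mem_filter] at he hf
      exact hM.snd_unique v e he.2 f hf.2 (hSv e he.1.1) (hSv f hf.1.1)) I.p y
    fun e he => hp e (Finset.mem_filter.1 (Finset.mem_filter.1 he).1).1
  set R := ∏ e ∈ (S.filter (· ∉ M₁)).filter (· ∉ M₂), (1 - I.p e * y e) with hRdef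
  have hR : 0 ≤ R := Finset.prod_nonneg fun e he => by
    simp only [Finset.mem_filter] at he
    have hE := hSE e he.1.1
    have := mul_le_one₀ (I.p_le_one e (I.mem_edges_iff.1 hE)) (h0 e hE) (h1 e hE)
    linarith
  have key : ∀ γ, ∏ e ∈ S, (1 - I.p e * shift y M₁ M₂ γ e) =
      (A - a * γ) * ((B - b * (-γ)) * R) := by
    intro γ
    rw [← Finset.prod_filter_mul_prod_filter_not S (· ∈ M₁),
      ← Finset.prod_filter_mul_prod_filter_not (S.filter (· ∉ M₁)) (· ∈ M₂), ← hA, ← hB, hRdef]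
    congr 1
    · refine Finset.prod_congr rfl fun e he => ?_
      rw [shift_fst (Finset.mem_filter.1 he).2]
    · congr 1
      · refine Finset.prod_congr rfl fun e he => ?_
        rw [hM.shift_snd (Finset.mem_filter.1 he).2, sub_eq_add_neg (y e)]
      · refine Finset.prod_congr rfl fun e he => ?_
        simp only [Finset.mem_filter] at he
        rw [shift_of_notMem he.1.2 he.2]
  have hzero : ∏ e ∈ S, (1 - I.p e * y e) = A * (B * R) := by
    have := key 0
    simp only [mul_zero, sub_zero, neg_zero] at this
    rw [← this]
    refine Finset.prod_congr rfl fun e _ => ?_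
    simp [shift]
  rw [hM.shift_swap, key, key, hzero]
  have hne : α + β ≠ 0 := by positivity
  have hgap : A * (B * R) - (β / (α + β) * ((A - a * α) * ((B - b * (-α)) * R)) +
      (1 - β / (α + β)) * ((A - a * (-β)) * ((B - b * (- -β)) * R))) = a * b * R * (α * β) := by
    field_simp
    ring
  have : 0 ≤ a * b * R * (α * β) := by positivity
  linarith

theorem RoundingStep.exists_alternate {V₁ V₂ : Set V} (hbip : I.graph.IsBipartiteWith V₁ V₂)
    {y y₁ y₂ : Sym2 V → ℝ} {q : ℝ} (h : I.RoundingStep y q y₁ y₂) :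
    ∃ (M₁ M₂ : Set (Sym2 V)) (α β : ℝ), Alternate (I.floating y) M₁ M₂ ∧
      IsLeast (hits y M₁ M₂) α ∧ IsLeast (hits y M₂ M₁) β ∧ q = β / (α + β) ∧
      y₁ = shift y M₁ M₂ α ∧ y₂ = shift y M₂ M₁ β := by
  obtain ⟨a, b, P, α, β, hP, h⟩ := h
  exact ⟨_, _, α, β, hP.alternate
    ⟨hbip.disjoint, fun v w hadj => hbip.mem_of_adj (I.floating_le y hadj)⟩, h⟩

theorem RoundingStep.patienceFeasible {V₁ V₂ : Set V} (hbip : I.graph.IsBipartiteWith V₁ V₂)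
    {y y₁ y₂ : Sym2 V → ℝ} {q : ℝ} (h : I.RoundingStep y q y₁ y₂) (hy : I.PatienceFeasible y) :
    I.PatienceFeasible y₁ ∧ I.PatienceFeasible y₂ := by
  obtain ⟨M₁, M₂, α, β, hM, hα, hβ, -, rfl, rfl⟩ := h.exists_alternate hbip
  exact ⟨hM.patienceFeasible_shift hα hy, hM.symm.patienceFeasible_shift hβ hy⟩

theorem RoundingStep.expected_prod_le {V₁ V₂ : Set V} (hbip : I.graph.IsBipartiteWith V₁ V₂)
    {y y₁ y₂ : Sym2 V → ℝ} {q : ℝ} (h : I.RoundingStep y q y₁ y₂) (hy : I.PatienceFeasible y)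
    {v : V} {S : Finset (Sym2 V)} (hS : S ⊆ I.inc v) :
    q * ∏ e ∈ S, (1 - I.p e * y₁ e) + (1 - q) * ∏ e ∈ S, (1 - I.p e * y₂ e) ≤
      ∏ e ∈ S, (1 - I.p e * y e) := by
  obtain ⟨M₁, M₂, α, β, hM, hα, hβ, rfl, rfl, rfl⟩ := h.exists_alternate hbip
  exact hM.expected_prod_le hS hy.nonneg hy.le_one hα.1.1 hβ.1.1

end Rounding

/-! ### Expected weight of a probing algorithm -/

section Expectation

variable {V : Type*}

/-- Conditioning on whether the edge `e` is active. -/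
theorem sum_powerset_split (p : Sym2 V → ℝ) {E : Finset (Sym2 V)} {e : Sym2 V} (he : e ∈ E)
    (F : Finset (Sym2 V) → ℝ) :
    ∑ A ∈ E.powerset, ((∏ i ∈ A, p i) * ∏ i ∈ E \ A, (1 - p i)) * F A =
      p e * ∑ A ∈ (E.erase e).powerset,
          ((∏ i ∈ A, p i) * ∏ i ∈ E.erase e \ A, (1 - p i)) * F (insert e A) +
        (1 - p e) * ∑ A ∈ (E.erase e).powerset,
          ((∏ i ∈ A, p i) * ∏ i ∈ E.erase e \ A, (1 - p i)) * F A := by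
  have hE : (E.erase e).powerset ⊆ E.powerset := Finset.powerset_mono.2 (Finset.erase_subset e E)
  conv_lhs => rw [← Finset.insert_erase he]
  rw [Finset.sum_powerset_insert (Finset.notMem_erase e E), add_comm, Finset.mul_sum,
    Finset.mul_sum]
  congr 1
  · refine Finset.sum_congr rfl fun A hA => ?_
    have heA : e ∉ A := fun h => Finset.notMem_erase e E (Finset.mem_powerset.1 hA h)
    have : insert e (E.erase e) \ insert e A = E.erase e \ A := by
      ext i
      simp only [Finset.mem_sdiff, Finset.mem_insert, Finset.mem_erase]
      tauto
    rw [Finset.prod_insert heA, this]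
    ring
  · refine Finset.sum_congr rfl fun A hA => ?_
    have heA : e ∉ A := fun h => Finset.notMem_erase e E (Finset.mem_powerset.1 hA h)
    rw [Finset.insert_sdiff_of_notMem _ heA, Finset.prod_insert (by simp)]
    ring

theorem sum_powerset_prob (p : Sym2 V → ℝ) (E : Finset (Sym2 V)) :
    ∑ A ∈ E.powerset, (∏ i ∈ A, p i) * ∏ i ∈ E \ A, (1 - p i) = 1 := by
  rw [← Finset.prod_add]
  simp

end Expectation

section Policies

variable {V : Type*} [Fintype V] (I : StochasticGraph V)

/-- The expected weight matched by a policy that probes no edge twice, by recursion on the tree. -/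
def treeValue : Policy V → ℝ
  | .halt => 0
  | .probe e a b => I.p e * (I.w e + treeValue a) + (1 - I.p e) * treeValue b
  | .coin q a b => q * treeValue a + (1 - q) * treeValue b

/-- The probability that a policy probes the edge `e`, if it probes no edge twice. -/
def probeProb (e : Sym2 V) : Policy V → ℝ
  | .halt => 0
  | .probe f a b =>
      (if e = f then 1 else 0) + (I.p f * probeProb e a + (1 - I.p f) * probeProb e b)
  | .coin q a b => q * probeProb e a + (1 - q) * probeProb e b

variable {I}

/-- The course of an admissible policy does not depend on the edges that have been probed before. -/
theorem weightOn_congr {π : Policy V} : ∀ {B M A A' : Finset (Sym2 V)}, I.Admissible B M π →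
    (∀ e, e ∉ B → (e ∈ A ↔ e ∈ A')) → I.weightOn A π = I.weightOn A' π := by
  induction π with
  | halt => intros; rfl
  | probe e a b iha ihb =>
    intro B M A A' h hA
    have hA' : ∀ f, f ∉ insert e B → (f ∈ A ↔ f ∈ A') := fun f hf =>
      hA f fun h => hf (Finset.mem_insert_of_mem h)
    simp only [weightOn, hA e h.1.2.1, iha h.2.1 hA', ihb h.2.2 hA']
  | coin q a b iha ihb =>
    intro B M A A' h hA
    simp only [weightOn, iha h.2.2.1 hA, ihb h.2.2.2 hA]

theorem Admissible.expected_weightOn {π : Policy V} : ∀ {B M : Finset (Sym2 V)},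
    I.Admissible B M π →
    ∑ A ∈ (I.edges \ B).powerset,
        ((∏ e ∈ A, I.p e) * ∏ e ∈ (I.edges \ B) \ A, (1 - I.p e)) * I.weightOn A π =
      I.treeValue π := by
  induction π with
  | halt => intros; simp [weightOn, treeValue]
  | probe e a b iha ihb =>
    intro B M h
    have he : e ∈ I.edges \ B := Finset.mem_sdiff.2 ⟨h.1.1, h.1.2.1⟩
    have hers : (I.edges \ B).erase e = I.edges \ insert e B := by
      ext f
      simp only [Finset.mem_erase, Finset.mem_sdiff, Finset.mem_insert]
      tauto
    rw [sum_powerset_split I.p he, hers, treeValue, ← iha h.2.1, ← ihb h.2.2]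
    congr 2
    · have hw : I.w e = ∑ A ∈ (I.edges \ insert e B).powerset,
          ((∏ f ∈ A, I.p f) * ∏ f ∈ (I.edges \ insert e B) \ A, (1 - I.p f)) * I.w e := by
        rw [← Finset.sum_mul, sum_powerset_prob, one_mul]
      rw [hw, ← Finset.sum_add_distrib]
      refine Finset.sum_congr rfl fun A _ => ?_
      have : I.weightOn (insert e A) a = I.weightOn A a := weightOn_congr h.2.1 fun f hf => by
        simp only [Finset.mem_insert, not_or] at hf
        simp [hf.1]
      simp only [weightOn, Finset.mem_insert_self, if_true, this]
      ring
    · refine Finset.sum_congr rfl fun A hA => ?_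
      have heA : e ∉ A := fun h => by
        simpa using (Finset.mem_sdiff.1 (Finset.mem_powerset.1 hA h)).2
      simp [weightOn, heA]
  | coin q a b iha ihb =>
    intro B M h
    rw [treeValue, ← iha h.2.2.1, ← ihb h.2.2.2, Finset.mul_sum, Finset.mul_sum,
      ← Finset.sum_add_distrib]
    refine Finset.sum_congr rfl fun A _ => ?_
    simp only [weightOn]
    ring

theorem IsProbingAlgorithm.expectedWeight_eq {π : Policy V} (h : I.IsProbingAlgorithm π) :
    I.expectedWeight π = I.treeValue π := by
  rw [← Admissible.expected_weightOn h, Finset.sdiff_empty]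
  rfl

/-! ### The linear program bounds every probing algorithm -/

theorem Admissible.treeValue_eq {π : Policy V} : ∀ {B M : Finset (Sym2 V)}, I.Admissible B M π →
    I.treeValue π = I.lpValue fun e => I.probeProb e π := by
  induction π with
  | halt => intros; simp [treeValue, lpValue, probeProb]
  | probe f a b iha ihb =>
    intro B M h
    have hf : I.p f * I.w f = ∑ e ∈ I.edges, I.w e * ((if e = f then 1 else 0) * I.p e) := by
      simp [h.1.1, mul_comm]
    rw [treeValue, mul_add, hf, iha h.2.1, ihb h.2.2]
    simp only [lpValue, probeProb, Finset.mul_sum, ← Finset.sum_add_distrib]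
    refine Finset.sum_congr rfl fun e _ => ?_
    ring
  | coin q a b iha ihb =>
    intro B M h
    rw [treeValue, iha h.2.2.1, ihb h.2.2.2]
    simp only [lpValue, probeProb, Finset.mul_sum, ← Finset.sum_add_distrib]
    refine Finset.sum_congr rfl fun e _ => ?_
    ring

theorem p_mem_Icc {e : Sym2 V} (he : e ∈ I.edges) : 0 ≤ I.p e ∧ I.p e ≤ 1 :=
  ⟨I.p_nonneg e (I.mem_edges_iff.1 he), I.p_le_one e (I.mem_edges_iff.1 he)⟩

theorem convex_comb_le {q x y z : ℝ} (h0 : 0 ≤ q) (h1 : q ≤ 1) (hx : x ≤ z) (hy : y ≤ z) :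
    q * x + (1 - q) * y ≤ z := by
  nlinarith

theorem Admissible.probeProb_nonneg {π : Policy V} (e : Sym2 V) : ∀ {B M : Finset (Sym2 V)},
    I.Admissible B M π → 0 ≤ I.probeProb e π := by
  induction π with
  | halt => intros; exact le_rfl
  | probe f a b iha ihb =>
    intro B M h
    have hp := p_mem_Icc h.1.1
    have h₁ := mul_nonneg hp.1 (iha h.2.1)
    have h₂ := mul_nonneg (sub_nonneg.2 hp.2) (ihb h.2.2)
    have h₃ : (0 : ℝ) ≤ if e = f then 1 else 0 := by split_ifs <;> norm_num
    simp only [probeProb]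
    linarith
  | coin q a b iha ihb =>
    intro B M h
    have h₁ := mul_nonneg h.1 (iha h.2.2.1)
    have h₂ := mul_nonneg (sub_nonneg.2 h.2.1) (ihb h.2.2.2)
    simp only [probeProb]
    linarith

theorem Admissible.probeProb_le {π : Policy V} (e : Sym2 V) : ∀ {B M : Finset (Sym2 V)},
    I.Admissible B M π → I.probeProb e π ≤ if e ∈ B then 0 else 1 := by
  induction π with
  | halt => intro B M _; simp only [probeProb]; split_ifs <;> norm_num
  | probe f a b iha ihb =>
    intro B M h
    have hp := p_mem_Icc h.1.1
    have := convex_comb_le hp.1 hp.2 (iha h.2.1) (ihb h.2.2)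
    simp only [probeProb]
    by_cases hef : e = f
    · subst hef
      simp only [Finset.mem_insert_self, if_true] at this
      simp only [h.1.2.1, if_true, if_false]
      linarith
    · simpa [hef] using this
  | coin q a b iha ihb =>
    intro B M h
    exact convex_comb_le h.1 h.2.1 (iha h.2.2.1) (ihb h.2.2.2)

theorem sum_probeProb_probe (v : V) (c : Sym2 V → ℝ) {f : Sym2 V} (hf : f ∈ I.edges)
    (a b : Policy V) :
    ∑ e ∈ I.inc v, I.probeProb e (.probe f a b) * c e =
      (if v ∈ f then c f else 0) + (I.p f * ∑ e ∈ I.inc v, I.probeProb e a * c e +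
        (1 - I.p f) * ∑ e ∈ I.inc v, I.probeProb e b * c e) := by
  have : (if v ∈ f then c f else 0) =
      ∑ e ∈ I.inc v, (if e = f then 1 else 0) * c e := by
    simp [mem_inc_iff, hf]
  rw [this]
  simp only [probeProb, Finset.mul_sum, ← Finset.sum_add_distrib]
  refine Finset.sum_congr rfl fun e _ => ?_
  ring

theorem sum_probeProb_coin (v : V) (c : Sym2 V → ℝ) (q : ℝ) (a b : Policy V) :
    ∑ e ∈ I.inc v, I.probeProb e (.coin q a b) * c e =
      q * ∑ e ∈ I.inc v, I.probeProb e a * c e +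
        (1 - q) * ∑ e ∈ I.inc v, I.probeProb e b * c e := by
  simp only [probeProb, Finset.mul_sum, ← Finset.sum_add_distrib]
  refine Finset.sum_congr rfl fun e _ => ?_
  ring

theorem Admissible.matching {π : Policy V} (v : V) : ∀ {B M : Finset (Sym2 V)},
    I.Admissible B M π →
    ∑ e ∈ I.inc v, I.probeProb e π * I.p e ≤ if ∃ f ∈ M, v ∈ f then 0 else 1 := by
  induction π with
  | halt => intro B M _; simp only [probeProb, zero_mul, Finset.sum_const_zero]; split_ifs <;> simp
  | probe f a b iha ihb =>
    intro B M h
    have hp := p_mem_Icc h.1.1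
    rw [sum_probeProb_probe v _ h.1.1]
    have ha := iha h.2.1
    have hb := ihb h.2.2
    by_cases hv : v ∈ f
    · have hM : ¬ ∃ g ∈ M, v ∈ g := fun ⟨g, hg, hvg⟩ => (h.1.2.2 v hv).1 g hg hvg
      rw [if_pos ⟨f, Finset.mem_insert_self _ _, hv⟩] at ha
      rw [if_neg hM] at hb
      rw [if_neg hM, if_pos hv]
      have := mul_le_mul_of_nonneg_left ha hp.1
      have := mul_le_mul_of_nonneg_left hb (sub_nonneg.2 hp.2)
      linarith
    · have hiff : (∃ g ∈ insert f M, v ∈ g) ↔ ∃ g ∈ M, v ∈ g := by simp [hv]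
      simp only [hiff] at ha
      rw [if_neg hv, zero_add]
      exact convex_comb_le hp.1 hp.2 ha hb
  | coin q a b iha ihb =>
    intro B M h
    rw [sum_probeProb_coin]
    exact convex_comb_le h.1 h.2.1 (iha h.2.2.1) (ihb h.2.2.2)

theorem Admissible.patience {π : Policy V} (v : V) {n : ℕ} (hn : I.t v = n) :
    ∀ {B M : Finset (Sym2 V)}, I.Admissible B M π → (B.filter (v ∈ ·)).card ≤ n →
    ∑ e ∈ I.inc v, I.probeProb e π * 1 ≤ (n : ℝ) - (B.filter (v ∈ ·)).card := by
  induction π with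
  | halt =>
    intro B M _ hB
    have : ((B.filter (v ∈ ·)).card : ℝ) ≤ n := by exact_mod_cast hB
    simpa [probeProb] using this
  | probe f a b iha ihb =>
    intro B M h hB
    have hp := p_mem_Icc h.1.1
    rw [sum_probeProb_probe v _ h.1.1]
    by_cases hv : v ∈ f
    · have hcard : ((insert f B).filter (v ∈ ·)).card = (B.filter (v ∈ ·)).card + 1 := by
        rw [Finset.filter_insert, if_pos hv, Finset.card_insert_of_notMem]
        exact fun hf => h.1.2.1 (Finset.mem_filter.1 hf).1
      have hlt := (h.1.2.2 v hv).2
      rw [hn] at hlt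
      have hlt' : (B.filter (v ∈ ·)).card < n := by exact_mod_cast hlt
      have ha := iha h.2.1 (by rw [hcard]; exact hlt')
      have hb := ihb h.2.2 (by rw [hcard]; exact hlt')
      have := convex_comb_le hp.1 hp.2 ha hb
      rw [hcard] at this
      push_cast at this
      rw [if_pos hv]
      linarith
    · have hfil : (insert f B).filter (v ∈ ·) = B.filter (v ∈ ·) := by
        rw [Finset.filter_insert, if_neg hv]
      have ha := iha h.2.1 (by rwa [hfil])
      have hb := ihb h.2.2 (by rwa [hfil])
      rw [hfil] at ha hb
      rw [if_neg hv, zero_add]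
      exact convex_comb_le hp.1 hp.2 ha hb
  | coin q a b iha ihb =>
    intro B M h hB
    rw [sum_probeProb_coin]
    exact convex_comb_le h.1 h.2.1 (iha h.2.2.1 hB) (ihb h.2.2.2 hB)

/-- The probabilities with which a probing algorithm probes the edges are a feasible solution of
the linear program. -/
theorem IsProbingAlgorithm.lpFeasible {π : Policy V} (h : I.IsProbingAlgorithm π) :
    I.LPFeasible fun e => I.probeProb e π where
  matching v := by simpa using Admissible.matching v h
  patience v n hn := by simpa using Admissible.patience v hn h (by simp)
  nonneg e _ := Admissible.probeProb_nonneg e h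
  le_one e _ := by simpa using Admissible.probeProb_le e h

theorem LPOptimal.expectedWeight_le {y : Sym2 V → ℝ} (hy : I.LPOptimal y) {π : Policy V}
    (h : I.IsProbingAlgorithm π) : I.expectedWeight π ≤ I.lpValue y := by
  rw [h.expectedWeight_eq, Admissible.treeValue_eq h]
  exact hy.2 _ h.lpFeasible

/-! ### Existence of an optimal solution -/

variable (I) in
/-- Off the edge set the linear program does not restrict `y`; with `0` there, the feasible
solutions form a compact set. -/
theorem exists_lpOptimal : ∃ y, I.LPOptimal y := by
  let K : Set (Sym2 V → ℝ) := {y | I.LPFeasible y ∧ ∀ e, e ∉ I.edges → y e = 0}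
  have hK : K = (⋂ v, {y | ∑ e ∈ I.inc v, y e * I.p e ≤ 1}) ∩
      (⋂ v, ⋂ n : ℕ, ⋂ _ : I.t v = n, {y | ∑ e ∈ I.inc v, y e ≤ (n : ℝ)}) ∩
      Set.univ.pi fun e => if e ∈ I.edges then Set.Icc (0 : ℝ) 1 else {0} := by
    ext y
    simp only [K, Set.mem_ofPred_eq, Set.mem_inter_iff, Set.mem_iInter, Set.mem_pi, Set.mem_univ,
      true_imp_iff]
    constructor
    · rintro ⟨h, h0⟩
      refine ⟨⟨h.matching, h.patience⟩, fun e => ?_⟩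
      split_ifs with he
      · exact ⟨h.nonneg e he, h.le_one e he⟩
      · exact h0 e he
    · rintro ⟨⟨h₁, h₂⟩, h₃⟩
      refine ⟨⟨h₁, h₂, fun e he => ?_, fun e he => ?_⟩, fun e he => ?_⟩
      · have := h₃ e
        rw [if_pos he] at this
        exact this.1
      · have := h₃ e
        rw [if_pos he] at this
        exact this.2
      · have := h₃ e
        rwa [if_neg he] at this
  have hcomp : IsCompact K := by
    rw [hK]
    refine IsCompact.inter_left (isCompact_univ_pi fun e => ?_) (IsClosed.inter ?_ ?_)
    · split_ifs
      · exact isCompact_Icc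
      · exact isCompact_singleton
    · exact isClosed_iInter fun v => isClosed_le (by fun_prop) (by fun_prop)
    · exact isClosed_iInter fun v => isClosed_iInter fun n => isClosed_iInter fun _ =>
        isClosed_le (by fun_prop) (by fun_prop)
  have hne : K.Nonempty := by
    refine ⟨0, ⟨fun v => ?_, fun v n _ => ?_, fun e _ => le_rfl, fun e _ => zero_le_one⟩,
      fun e _ => rfl⟩
    · simp
    · simp
  obtain ⟨y, hy, hmax⟩ := hcomp.exists_isMaxOn hne (f := I.lpValue)
    (Continuous.continuousOn (by unfold lpValue; fun_prop))
  refine ⟨y, hy.1, fun y' hy' => ?_⟩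
  let z : Sym2 V → ℝ := fun e => if e ∈ I.edges then y' e else 0
  have hz : ∀ e ∈ I.edges, z e = y' e := fun e he => if_pos he
  have hinc : ∀ v, ∀ e ∈ I.inc v, z e = y' e := fun v e he => hz e (I.mem_inc_iff.1 he).1
  have hval : I.lpValue y' = I.lpValue z :=
    Finset.sum_congr rfl fun e he => by rw [hz e he]
  rw [hval]
  refine hmax (a := z) ⟨⟨fun v => ?_, fun v n hn => ?_, fun e he => ?_, fun e he => ?_⟩,
    fun e he => if_neg he⟩
  · rw [Finset.sum_congr rfl fun e he => by rw [hinc v e he]]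
    exact hy'.matching v
  · rw [Finset.sum_congr rfl (hinc v)]
    exact hy'.patience v n hn
  · rw [hz e he]
    exact hy'.nonneg e he
  · rw [hz e he]
    exact hy'.le_one e he

end Policies

/-! ### Expected weight of a star -/

section Star

variable {ι : Type*}

/-- The expected weight obtained by probing the elements of a list in order until one is active, if
they are active independently, each `e` with probability `z e`. -/
def starValue (w z : ι → ℝ) : List ι → ℝ
  | [] => 0
  | e :: l => z e * w e + (1 - z e) * starValue w z l

/-- Moving an element behind heavier ones does not decrease the value of a star. -/
theorem starValue_cons_append_le (w z : ι → ℝ) (e : ι) (l₂ : List ι) (he0 : 0 ≤ z e) :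
    ∀ l₁ : List ι, (∀ f ∈ l₁, 0 ≤ z f ∧ z f ≤ 1 ∧ w e ≤ w f) →
      starValue w z (e :: (l₁ ++ l₂)) ≤ starValue w z (l₁ ++ e :: l₂)
  | [], _ => le_rfl
  | f :: l₁, h => by
    have hf := h f List.mem_cons_self
    have ih := starValue_cons_append_le w z e l₂ he0 l₁ fun g hg => h g (List.mem_cons_of_mem f hg)
    have ih' := mul_le_mul_of_nonneg_left ih (sub_nonneg.2 hf.2.1)
    have hswap := mul_nonneg (mul_nonneg he0 hf.1) (sub_nonneg.2 hf.2.2)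
    simp only [List.cons_append, starValue] at ih' ⊢
    linarith

/-- Probing in decreasing order of weight is optimal; in particular, the order among elements of
equal weight does not matter. -/
theorem starValue_le_of_perm (w z : ι → ℝ) : ∀ l' l : List ι, l'.Perm l →
    l.Pairwise (fun e f => w f ≤ w e) → (∀ e ∈ l, 0 ≤ z e ∧ z e ≤ 1) →
    starValue w z l' ≤ starValue w z l
  | [], l, hp, _, _ => by rw [hp.nil_eq]
  | e :: l', l, hp, hl, hz => by
    have hel : e ∈ l := hp.mem_iff.1 List.mem_cons_self
    obtain ⟨l₁, l₂, rfl⟩ := List.append_of_mem hel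
    have hp' : l'.Perm (l₁ ++ l₂) := (hp.trans List.perm_middle).cons_inv
    have hsub : (l₁ ++ l₂).Sublist (l₁ ++ e :: l₂) :=
      (List.Sublist.refl _).append (List.sublist_cons_self _ _)
    have hl₁ : ∀ f ∈ l₁, w e ≤ w f := fun f hf =>
      (List.pairwise_append.1 hl).2.2 f hf e List.mem_cons_self
    have ih := starValue_le_of_perm w z l' (l₁ ++ l₂) hp' (hl.sublist hsub) fun f hf =>
      hz f (hsub.subset hf)
    have he := hz e hel
    refine le_trans ?_ (starValue_cons_append_le w z e l₂ he.1 l₁ fun f hf =>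
      ⟨(hz f (by simp [hf])).1, (hz f (by simp [hf])).2, hl₁ f hf⟩)
    simp only [starValue]
    have := mul_le_mul_of_nonneg_left ih (sub_nonneg.2 he.2)
    linarith

/-- Elements whose probability is `0` may be dropped. -/
theorem starValue_filter (w p Y : ι → ℝ) : ∀ l : List ι, (∀ e ∈ l, Y e = 0 ∨ Y e = 1) →
    starValue w (fun e => p e * Y e) l = starValue w p (l.filter fun e => Y e = 1)
  | [], _ => rfl
  | e :: l, h => by
    have ih := starValue_filter w p Y l fun f hf => h f (List.mem_cons_of_mem e hf)
    rcases h e List.mem_cons_self with he | he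
    · simp [starValue, ih, he]
    · simp [starValue, ih, he]

/-- Summation by parts.  For a list in decreasing order of weight, the value of the star is a
nonnegative combination, whose coefficients are the successive differences of the weights, of the
probabilities that an initial segment contains an active element. -/
theorem exists_layers (w : ι → ℝ) : ∀ l : List ι, l.Nodup →
    l.Pairwise (fun e f => w f ≤ w e) → (∀ e ∈ l, 0 ≤ w e) →
    ∃ C : List (ℝ × Finset ι), (∀ c ∈ C, 0 ≤ c.1 ∧ ∀ e ∈ c.2, e ∈ l) ∧
      (∀ W, 0 ≤ W → (∀ e ∈ l, w e ≤ W) → (C.map Prod.fst).sum ≤ W) ∧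
      ∀ z : ι → ℝ,
        starValue w z l = (C.map fun c => c.1 * (1 - ∏ e ∈ c.2, (1 - z e))).sum ∧
        (l.map fun e => w e * z e).sum = (C.map fun c => c.1 * ∑ e ∈ c.2, z e).sum
  | [], _, _, _ => ⟨[], by simp, by simp, by simp [starValue]⟩
  | e :: l, hnd, hs, h0 => by
    obtain ⟨C, hC, hW, hz⟩ := exists_layers w l (List.nodup_cons.1 hnd).2
      (List.pairwise_cons.1 hs).2 fun f hf => h0 f (List.mem_cons_of_mem e hf)
    have he0 := h0 e List.mem_cons_self
    have hle := hW (w e) he0 (List.pairwise_cons.1 hs).1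
    have hnot : ∀ c ∈ C, e ∉ c.2 := fun c hc h => (List.nodup_cons.1 hnd).1 ((hC c hc).2 e h)
    refine ⟨(w e - (C.map Prod.fst).sum, {e}) :: C.map fun c => (c.1, insert e c.2),
      ?_, ?_, fun z => ⟨?_, ?_⟩⟩
    · intro c hc
      rcases List.mem_cons.1 hc with rfl | hc
      · exact ⟨sub_nonneg.2 hle, by simp⟩
      · obtain ⟨d, hd, rfl⟩ := List.mem_map.1 hc
        refine ⟨(hC d hd).1, fun f hf => ?_⟩
        rcases Finset.mem_insert.1 hf with rfl | hf
        · exact List.mem_cons_self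
        · exact List.mem_cons_of_mem _ ((hC d hd).2 f hf)
    · intro W _ hWe
      have := hWe e List.mem_cons_self
      simpa [Function.comp_def] using this
    · have hmap : (C.map fun c => c.1 * (1 - ∏ f ∈ insert e c.2, (1 - z f))) =
          C.map fun c => (1 - z e) * (c.1 * (1 - ∏ f ∈ c.2, (1 - z f))) + c.1 * z e :=
        List.map_congr_left fun c hc => by
          rw [Finset.prod_insert (hnot c hc)]
          ring
      simp only [List.map_cons, List.map_map, Function.comp_def, List.sum_cons, starValue,
        Finset.prod_singleton, hmap, List.sum_map_add, List.sum_map_mul_left,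
        List.sum_map_mul_right, (hz z).1]
      ring
    · have hmap : (C.map fun c => c.1 * ∑ f ∈ insert e c.2, z f) =
          C.map fun c => c.1 * z e + c.1 * ∑ f ∈ c.2, z f :=
        List.map_congr_left fun c hc => by
          rw [Finset.sum_insert (hnot c hc)]
          ring
      simp only [List.map_cons, List.map_map, Function.comp_def, List.sum_cons,
        Finset.sum_singleton, hmap, List.sum_map_add, List.sum_map_mul_right, (hz z).2]
      ring

theorem starValue_le_convex_comb {w : ι → ℝ} {l : List ι} (hnd : l.Nodup)
    (hs : l.Pairwise fun e f => w f ≤ w e) (h0 : ∀ e ∈ l, 0 ≤ w e) {z z₁ z₂ : ι → ℝ} {q : ℝ}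
    (hq : ∀ S : Finset ι, (∀ e ∈ S, e ∈ l) →
      q * ∏ e ∈ S, (1 - z₁ e) + (1 - q) * ∏ e ∈ S, (1 - z₂ e) ≤ ∏ e ∈ S, (1 - z e)) :
    starValue w z l ≤ q * starValue w z₁ l + (1 - q) * starValue w z₂ l := by
  obtain ⟨C, hC, -, hz⟩ := exists_layers w l hnd hs h0
  rw [(hz z).1, (hz z₁).1, (hz z₂).1, ← List.sum_map_mul_left, ← List.sum_map_mul_left,
    ← List.sum_map_add]
  refine List.sum_le_sum fun c hc => ?_
  have := mul_le_mul_of_nonneg_left (hq c.2 (hC c hc).2) (hC c hc).1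
  linarith

theorem one_sub_inv_exp_mul_le {x : ℝ} (h0 : 0 ≤ x) (h1 : x ≤ 1) :
    (1 - 1 / Real.exp 1) * x ≤ 1 - Real.exp (-x) := by
  have := convexOn_exp.2 (Set.mem_univ 0) (Set.mem_univ (-1)) (sub_nonneg.2 h1) h0 (by ring)
  simp only [smul_eq_mul, mul_zero, zero_add, Real.exp_zero, mul_one, mul_neg] at this
  rw [Real.exp_neg 1, ← one_div] at this
  linarith

/-- `∏ (1 - z e) ≤ exp (-∑ z e)`, and `1 - exp (-x)` lies above its chord on `[0, 1]`. -/
theorem one_sub_inv_exp_mul_sum_le {z : ι → ℝ} {S : Finset ι} (h0 : ∀ e ∈ S, 0 ≤ z e)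
    (h1 : ∀ e ∈ S, z e ≤ 1) (hS : ∑ e ∈ S, z e ≤ 1) :
    (1 - 1 / Real.exp 1) * ∑ e ∈ S, z e ≤ 1 - ∏ e ∈ S, (1 - z e) := by
  have hprod : ∏ e ∈ S, (1 - z e) ≤ Real.exp (-∑ e ∈ S, z e) := by
    rw [← Finset.sum_neg_distrib, Real.exp_sum]
    exact Finset.prod_le_prod (fun e he => sub_nonneg.2 (h1 e he))
      fun e _ => Real.one_sub_le_exp_neg (z e)
  linarith [one_sub_inv_exp_mul_le (Finset.sum_nonneg h0) hS]

theorem one_sub_inv_exp_mul_le_starValue {w : ι → ℝ} {l : List ι} (hnd : l.Nodup)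
    (hs : l.Pairwise fun e f => w f ≤ w e) (h0 : ∀ e ∈ l, 0 ≤ w e) {z : ι → ℝ}
    (hz0 : ∀ e ∈ l, 0 ≤ z e) (hz1 : ∀ e ∈ l, z e ≤ 1) (hsum : (l.map z).sum ≤ 1) :
    (1 - 1 / Real.exp 1) * (l.map fun e => w e * z e).sum ≤ starValue w z l := by
  obtain ⟨C, hC, -, hz⟩ := exists_layers w l hnd hs h0
  rw [(hz z).1, (hz z).2, ← List.sum_map_mul_left]
  refine List.sum_le_sum fun c hc => ?_
  obtain ⟨hc0, hcl⟩ := hC c hc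
  have hle : ∑ e ∈ c.2, z e ≤ 1 := by
    refine le_trans ?_ hsum
    rw [← List.sum_toFinset z hnd]
    exact Finset.sum_le_sum_of_subset_of_nonneg (fun e he => List.mem_toFinset.2 (hcl e he))
      fun e he _ => hz0 e (List.mem_toFinset.1 he)
  have := mul_le_mul_of_nonneg_left (one_sub_inv_exp_mul_sum_le (fun e he => hz0 e (hcl e he))
    (fun e he => hz1 e (hcl e he)) hle) hc0
  linarith

end Star

/-! ### The probing phase -/

section Trees

variable {V : Type*} {I : StochasticGraph V}

theorem treeValue_probeStar (next : Policy V) (l : List (Sym2 V)) :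
    I.treeValue (probeStar next l) = starValue I.w I.p l + I.treeValue next := by
  induction l with
  | nil => simp [probeStar, starValue]
  | cons e l ih =>
    simp only [probeStar, starValue, treeValue, ih]
    ring

theorem treeValue_probeStars (vs : List V) (star : V → List (Sym2 V)) :
    I.treeValue (probeStars (vs.map star)) =
      (vs.map fun v => starValue I.w I.p (star v)).sum := by
  induction vs with
  | nil => rfl
  | cons v vs ih => simp [probeStars, treeValue_probeStar, ih]

theorem pairwise_insertionSort_weight (l : List (Sym2 V)) :
    (l.insertionSort fun e f => I.w f ≤ I.w e).Pairwise fun e f => I.w f ≤ I.w e := by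
  have : Std.Total fun e f : Sym2 V => I.w f ≤ I.w e := ⟨fun e f => le_total (I.w f) (I.w e)⟩
  have : IsTrans (Sym2 V) fun e f : Sym2 V => I.w f ≤ I.w e := ⟨fun _ _ _ h₁ h₂ => h₂.trans h₁⟩
  exact List.pairwise_insertionSort _ l

end Trees

section Algorithm

variable {V : Type*} [Fintype V] {I : StochasticGraph V}

theorem eq_or_mem_of_mem_edge {V₁ V₂ : Finset V}
    (hbip : I.graph.IsBipartiteWith (V₁ : Set V) (V₂ : Set V)) {e : Sym2 V} (he : e ∈ I.edges)
    {v x : V} (hv : v ∈ V₂) (hve : v ∈ e) (hxe : x ∈ e) : x = v ∨ x ∈ V₁ := by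
  obtain ⟨u, rfl⟩ := Sym2.mem_iff_exists.1 hve
  have hadj : I.graph.Adj v u := I.mem_edges_iff.1 he
  rcases Sym2.mem_iff.1 hxe with h | rfl
  · exact Or.inl h
  · exact Or.inr (hbip.symm.mem_of_mem_adj hv hadj)

/-- The edges to which the rounding procedure has given the value `1`. -/
def selected (I : StochasticGraph V) (Y : Sym2 V → ℝ) : Finset (Sym2 V) :=
  I.edges.filter fun e => Y e = 1

theorem mem_selected_iff {Y : Sym2 V → ℝ} {e : Sym2 V} :
    e ∈ I.selected Y ↔ e ∈ I.edges ∧ Y e = 1 := by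
  simp [selected]

theorem PatienceFeasible.card_selected_le {Y : Sym2 V → ℝ} (hY : I.PatienceFeasible Y)
    (hint : ∀ e ∈ I.edges, Y e = 0 ∨ Y e = 1) (v : V) :
    (((I.selected Y).filter (v ∈ ·)).card : ℕ∞) ≤ I.t v := by
  rcases h : I.t v with _ | n
  · exact le_top
  · have hsum := hY.patience v n h
    have hcard : ∑ e ∈ I.inc v, Y e = ((I.selected Y).filter (v ∈ ·)).card := by
      have : (I.selected Y).filter (v ∈ ·) = (I.inc v).filter fun e => Y e = 1 := by
        ext e
        simp only [Finset.mem_filter, mem_selected_iff, mem_inc_iff]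
        tauto
      rw [this, Finset.card_filter, Nat.cast_sum]
      refine Finset.sum_congr rfl fun e he => ?_
      rcases hint e (I.mem_inc_iff.1 he).1 with h | h <;> simp [h]
    rw [hcard] at hsum
    have : ((I.selected Y).filter (v ∈ ·)).card ≤ n := by exact_mod_cast hsum
    exact Nat.cast_le.2 this

/-- A selected edge at `v` is safe if only other selected edges have been probed and `v` has not
been matched: its other end, which has patience one, is on no other selected edge. -/
theorem safe_of_selected {V₁ V₂ : Finset V}
    (hbip : I.graph.IsBipartiteWith (V₁ : Set V) (V₂ : Set V)) (hunit : ∀ u ∈ V₁, I.t u = 1)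
    {Y : Sym2 V → ℝ} (hdeg : ∀ v, (((I.selected Y).filter (v ∈ ·)).card : ℕ∞) ≤ I.t v)
    {B M : Finset (Sym2 V)} (hB : B ⊆ I.selected Y) (hM : M ⊆ B) {v : V} (hv : v ∈ V₂)
    {e : Sym2 V} (he : e ∈ I.selected Y) (hve : v ∈ e) (heB : e ∉ B) (hvM : ∀ f ∈ M, v ∉ f) :
    I.Safe B M e := by
  have heE := (mem_selected_iff.1 he).1
  refine ⟨heE, heB, fun x hx => ⟨?_, ?_⟩⟩
  · rcases eq_or_mem_of_mem_edge hbip heE hv hve hx with rfl | hxV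
    · exact hvM
    · intro f hf hxf
      have hcard := hdeg x
      rw [hunit x hxV] at hcard
      have hcard' : ((I.selected Y).filter (x ∈ ·)).card ≤ 1 := by exact_mod_cast hcard
      have := Finset.card_le_one.1 hcard' e (Finset.mem_filter.2 ⟨he, hx⟩) f
        (Finset.mem_filter.2 ⟨hB (hM hf), hxf⟩)
      exact heB (this ▸ hM hf)
  · refine lt_of_lt_of_le ?_ (hdeg x)
    have hss : B.filter (x ∈ ·) ⊂ (I.selected Y).filter (x ∈ ·) :=
      (Finset.ssubset_iff_of_subset (Finset.filter_subset_filter _ hB)).2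
        ⟨e, Finset.mem_filter.2 ⟨he, hx⟩, fun h => heB (Finset.mem_filter.1 h).1⟩
    exact_mod_cast Finset.card_lt_card hss

theorem admissible_probeStar {V₁ V₂ : Finset V}
    (hbip : I.graph.IsBipartiteWith (V₁ : Set V) (V₂ : Set V)) (hunit : ∀ u ∈ V₁, I.t u = 1)
    {Y : Sym2 V → ℝ} (hdeg : ∀ v, (((I.selected Y).filter (v ∈ ·)).card : ℕ∞) ≤ I.t v)
    {v : V} (hv : v ∈ V₂) (next : Policy V) : ∀ (l : List (Sym2 V)) (B M : Finset (Sym2 V)),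
    l.Nodup → (∀ e ∈ l, e ∈ I.selected Y ∧ v ∈ e ∧ e ∉ B) → B ⊆ I.selected Y → M ⊆ B →
    (∀ f ∈ M, v ∉ f) →
    (∀ B' M', B' ⊆ I.selected Y → M' ⊆ B' → (∀ f ∈ B', f ∈ B ∨ v ∈ f) →
      I.Admissible B' M' next) →
    I.Admissible B M (probeStar next l)
  | [], B, M, _, _, hB, hM, _, hnext => hnext B M hB hM fun f hf => Or.inl hf
  | e :: l, B, M, hnd, hl, hB, hM, hvM, hnext => by
    obtain ⟨he, hve, heB⟩ := hl e List.mem_cons_self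
    have hB' : insert e B ⊆ I.selected Y := Finset.insert_subset he hB
    refine ⟨safe_of_selected hbip hunit hdeg hB hM hv he hve heB hvM,
      hnext _ _ hB' (Finset.insert_subset_insert e hM) fun f hf => ?_,
      admissible_probeStar hbip hunit hdeg hv next l _ M (List.nodup_cons.1 hnd).2
        (fun f hf => ?_) hB' (hM.trans (Finset.subset_insert e B)) hvM
        fun B₁ M₁ h₁ h₂ h₃ => hnext B₁ M₁ h₁ h₂ fun f hf => ?_⟩
    · rcases Finset.mem_insert.1 hf with rfl | hf
      · exact Or.inr hve
      · exact Or.inl hf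
    · obtain ⟨h₁, h₂, h₃⟩ := hl f (List.mem_cons_of_mem e hf)
      refine ⟨h₁, h₂, fun h => ?_⟩
      rcases Finset.mem_insert.1 h with rfl | h
      · exact (List.nodup_cons.1 hnd).1 hf
      · exact h₃ h
    · rcases h₃ f hf with h | h
      · rcases Finset.mem_insert.1 h with rfl | h
        · exact Or.inr hve
        · exact Or.inl h
      · exact Or.inr h

theorem admissible_probeStars {V₁ V₂ : Finset V}
    (hbip : I.graph.IsBipartiteWith (V₁ : Set V) (V₂ : Set V)) (hunit : ∀ u ∈ V₁, I.t u = 1)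
    {Y : Sym2 V → ℝ} (hdeg : ∀ v, (((I.selected Y).filter (v ∈ ·)).card : ℕ∞) ≤ I.t v)
    {star : V → List (Sym2 V)} : ∀ (vs : List V) (B M : Finset (Sym2 V)), vs.Nodup →
    (∀ v ∈ vs, v ∈ V₂ ∧ (star v).Nodup ∧ ∀ e ∈ star v, e ∈ I.selected Y ∧ v ∈ e) →
    B ⊆ I.selected Y → M ⊆ B → (∀ v ∈ vs, ∀ f ∈ B, v ∉ f) →
    I.Admissible B M (probeStars (vs.map star))
  | [], _, _, _, _, _, _, _ => trivial
  | v :: vs, B, M, hnd, hstar, hB, hM, hvB => by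
    obtain ⟨hv, hsnd, hs⟩ := hstar v List.mem_cons_self
    have hvB' := hvB v List.mem_cons_self
    refine admissible_probeStar hbip hunit hdeg hv _ (star v) B M hsnd
      (fun e he => ⟨(hs e he).1, (hs e he).2, fun h => hvB' e h (hs e he).2⟩) hB hM
      (fun f hf => hvB' f (hM hf)) fun B' M' hB' hM' hBB' =>
        admissible_probeStars hbip hunit hdeg vs B' M' (List.nodup_cons.1 hnd).2
          (fun u hu => hstar u (List.mem_cons_of_mem v hu)) hB' hM' fun u hu f hf huf => ?_
    rcases hBB' f hf with h | h
    · exact hvB u (List.mem_cons_of_mem v hu) f h huf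
    · -- an edge has only one end in `V₂`
      rcases eq_or_mem_of_mem_edge hbip (mem_selected_iff.1 (hB' hf)).1 hv h huf with rfl | hu₁
      · exact (List.nodup_cons.1 hnd).1 hu
      · exact Set.disjoint_left.1 hbip.disjoint hu₁ (hstar u (List.mem_cons_of_mem v hu)).1

variable (I) in
/-- The edges at `v` in decreasing order of weight, with ties broken in some fixed way. -/
def sortedInc (v : V) : List (Sym2 V) :=
  (I.inc v).toList.insertionSort fun e f => I.w f ≤ I.w e

theorem sortedInc_perm (v : V) : (I.sortedInc v).Perm (I.inc v).toList :=
  List.perm_insertionSort _ _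

theorem mem_sortedInc {v : V} {e : Sym2 V} : e ∈ I.sortedInc v ↔ e ∈ I.inc v := by
  rw [(sortedInc_perm v).mem_iff, Finset.mem_toList]

theorem nodup_sortedInc (v : V) : (I.sortedInc v).Nodup :=
  (sortedInc_perm v).nodup_iff.2 (Finset.nodup_toList _)

theorem sum_map_sortedInc (v : V) (c : Sym2 V → ℝ) :
    ((I.sortedInc v).map c).sum = ∑ e ∈ I.inc v, c e := by
  rw [((sortedInc_perm v).map c).sum_eq, Finset.sum_map_toList]

theorem w_nonneg_of_mem_inc {v : V} {e : Sym2 V} (he : e ∈ I.inc v) : 0 ≤ I.w e :=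
  I.w_nonneg e (I.mem_edges_iff.1 (I.mem_inc_iff.1 he).1)

variable (I) in
/-- The value at `v` of a fractional solution `y`: the expected weight of the star at `v` if each
edge `e` were to be both selected and active with probability `p e * y e`, independently. -/
def vertexValue (y : Sym2 V → ℝ) (v : V) : ℝ :=
  starValue I.w (fun e => I.p e * y e) (I.sortedInc v)

theorem vertexValue_le_starValue {Y : Sym2 V → ℝ} (hint : ∀ e ∈ I.edges, Y e = 0 ∨ Y e = 1)
    {v : V} {l : List (Sym2 V)} (hnd : l.Nodup) (hl : ∀ e, e ∈ l ↔ e ∈ I.inc v ∧ Y e = 1)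
    (hs : l.Pairwise fun e f => I.w f ≤ I.w e) : I.vertexValue Y v ≤ starValue I.w I.p l := by
  rw [vertexValue, starValue_filter I.w I.p Y _ fun e he =>
    hint e (I.mem_inc_iff.1 (mem_sortedInc.1 he)).1]
  refine starValue_le_of_perm _ _ _ _ ?_ hs fun e he =>
    p_mem_Icc (I.mem_inc_iff.1 ((hl e).1 he).1).1
  rw [List.perm_ext_iff_of_nodup ((nodup_sortedInc v).filter _) hnd]
  intro e
  simp [hl, mem_sortedInc]

theorem RoundingStep.vertexValue_le {V₁ V₂ : Set V} (hbip : I.graph.IsBipartiteWith V₁ V₂)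
    {y y₁ y₂ : Sym2 V → ℝ} {q : ℝ} (h : I.RoundingStep y q y₁ y₂) (hy : I.PatienceFeasible y)
    (v : V) : I.vertexValue y v ≤ q * I.vertexValue y₁ v + (1 - q) * I.vertexValue y₂ v :=
  starValue_le_convex_comb (nodup_sortedInc v) (pairwise_insertionSort_weight _)
    (fun _ he => w_nonneg_of_mem_inc (mem_sortedInc.1 he))
    fun _ hS => h.expected_prod_le hbip hy fun e he => mem_sortedInc.1 (hS e he)

theorem LPFeasible.le_vertexValue {y : Sym2 V → ℝ} (hy : I.LPFeasible y) (v : V) :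
    (1 - 1 / Real.exp 1) * ∑ e ∈ I.inc v, I.w e * I.p e * y e ≤ I.vertexValue y v := by
  have hE : ∀ e ∈ I.sortedInc v, e ∈ I.edges := fun e he =>
    (I.mem_inc_iff.1 (mem_sortedInc.1 he)).1
  have := one_sub_inv_exp_mul_le_starValue (nodup_sortedInc (I := I) v)
    (pairwise_insertionSort_weight _)
    (fun _ he => w_nonneg_of_mem_inc (mem_sortedInc.1 he)) (z := fun e => I.p e * y e)
    (fun e he => mul_nonneg (p_mem_Icc (hE e he)).1 (hy.nonneg e (hE e he)))
    (fun e he => mul_le_one₀ (p_mem_Icc (hE e he)).2 (hy.nonneg e (hE e he))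
      (hy.le_one e (hE e he)))
    (by
      rw [sum_map_sortedInc]
      simpa only [mul_comm] using hy.matching v)
  rw [sum_map_sortedInc] at this
  simpa only [mul_assoc, vertexValue] using this

/-! ### Analysis of the algorithm -/

/-- Along the rounding, the total value of the vertices is a submartingale; once the vector is
integral, this total is at most the expected weight of the probing phase. -/
theorem RoundThenProbe.analysis {V₁ V₂ : Finset V}
    (hbip : I.graph.IsBipartiteWith (V₁ : Set V) (V₂ : Set V)) (hunit : ∀ u ∈ V₁, I.t u = 1)
    {y : Sym2 V → ℝ} {π : Policy V} (h : I.RoundThenProbe V₂ y π) (hy : I.PatienceFeasible y) :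
    I.IsProbingAlgorithm π ∧ ∑ v ∈ V₂, I.vertexValue y v ≤ I.treeValue π := by
  induction h with
  | probe Y π integral stars =>
    obtain ⟨vs, star, hnd, hvs, hstar, rfl⟩ := stars
    refine ⟨admissible_probeStars hbip hunit (hy.card_selected_le integral) vs ∅ ∅ hnd
      (fun v hv => ?_) (by simp) (by simp) (by simp), ?_⟩
    · have hv₂ := (hvs v).1 hv
      obtain ⟨h₁, h₂, -⟩ := hstar v hv₂
      refine ⟨hv₂, h₁, fun e he => ?_⟩
      obtain ⟨h₃, h₄⟩ := (h₂ e).1 he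
      obtain ⟨h₅, h₆⟩ := I.mem_inc_iff.1 h₃
      exact ⟨mem_selected_iff.2 ⟨h₅, h₄⟩, h₆⟩
    · have hV : vs.toFinset = V₂ := by
        ext v
        simp [hvs]
      rw [treeValue_probeStars, ← List.sum_toFinset _ hnd, hV]
      refine Finset.sum_le_sum fun v hv => ?_
      obtain ⟨h₁, h₂, h₃⟩ := hstar v hv
      exact vertexValue_le_starValue integral h₁ h₂ h₃
  | round y y₁ y₂ q π₁ π₂ step run₁ run₂ ih₁ ih₂ =>
    obtain ⟨hq0, hq1⟩ := step.prob_mem_Icc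
    obtain ⟨hy₁, hy₂⟩ := step.patienceFeasible hbip hy
    obtain ⟨ha₁, hv₁⟩ := ih₁ hy₁
    obtain ⟨ha₂, hv₂⟩ := ih₂ hy₂
    refine ⟨⟨hq0, hq1, ha₁, ha₂⟩, ?_⟩
    calc ∑ v ∈ V₂, I.vertexValue y v
        ≤ ∑ v ∈ V₂, (q * I.vertexValue y₁ v + (1 - q) * I.vertexValue y₂ v) :=
          Finset.sum_le_sum fun v _ => step.vertexValue_le hbip hy v
      _ = q * ∑ v ∈ V₂, I.vertexValue y₁ v + (1 - q) * ∑ v ∈ V₂, I.vertexValue y₂ v := by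
          rw [Finset.sum_add_distrib, Finset.mul_sum, Finset.mul_sum]
      _ ≤ q * I.treeValue π₁ + (1 - q) * I.treeValue π₂ :=
          add_le_add (mul_le_mul_of_nonneg_left hv₁ hq0)
            (mul_le_mul_of_nonneg_left hv₂ (sub_nonneg.2 hq1))

theorem exists_probesStars (V₂ : Finset V) (Y : Sym2 V → ℝ) : ∃ π, I.ProbesStars V₂ Y π := by
  refine ⟨_, V₂.toList, fun v => ((I.inc v).filter fun e => Y e = 1).toList.insertionSort
    fun e f => I.w f ≤ I.w e, Finset.nodup_toList _, fun v => Finset.mem_toList, fun v _ =>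
    ⟨?_, fun e => ?_, pairwise_insertionSort_weight _⟩, rfl⟩
  · exact (List.perm_insertionSort _ _).nodup_iff.2 (Finset.nodup_toList _)
  · rw [List.mem_insertionSort, Finset.mem_toList, Finset.mem_filter]

/-- The rounding can be carried out and terminates, as each step makes an edge integral. -/
theorem exists_roundThenProbe {V₁ V₂ : Finset V}
    (hbip : I.graph.IsBipartiteWith (V₁ : Set V) (V₂ : Set V)) {y : Sym2 V → ℝ}
    (hy : I.PatienceFeasible y) : ∃ π, I.RoundThenProbe V₂ y π := by
  induction hn : (I.edges.filter fun e => 0 < y e ∧ y e < 1).card using Nat.strong_induction_on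
    generalizing y with
  | _ n ih =>
    by_cases hfl : ∃ e, e ∈ (I.floating y).edgeSet
    · obtain ⟨e, he⟩ := hfl
      obtain ⟨a, b, P, hP⟩ := exists_isRoundingWalk he
      have hM := hP.alternate
        ⟨hbip.disjoint, fun v w hadj => hbip.mem_of_adj (I.floating_le y hadj)⟩
      obtain ⟨α, hα⟩ := hM.exists_isLeast_hits
      obtain ⟨β, hβ⟩ := hM.symm.exists_isLeast_hits
      obtain ⟨π₁, h₁⟩ := ih _ (hn ▸ hM.card_floating_shift_lt hα)
        (hM.patienceFeasible_shift hα hy) rfl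
      obtain ⟨π₂, h₂⟩ := ih _ (hn ▸ hM.symm.card_floating_shift_lt hβ)
        (hM.symm.patienceFeasible_shift hβ hy) rfl
      exact ⟨_, .round y _ _ _ π₁ π₂ ⟨a, b, P, α, β, hP, hα, hβ, rfl, rfl, rfl⟩ h₁ h₂⟩
    · obtain ⟨π, hπ⟩ := exists_probesStars (I := I) V₂ y
      refine ⟨π, .probe y π (fun e he => ?_) hπ⟩
      by_contra hcon
      push Not at hcon
      exact hfl ⟨e, I.mem_floating_iff.2 ⟨he, lt_of_le_of_ne (hy.nonneg e he) hcon.1.symm,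
        lt_of_le_of_ne (hy.le_one e he) hcon.2⟩⟩

/-- Each edge of a bipartite graph is counted at exactly one vertex of `V₂`. -/
theorem sum_sum_inc_eq_lpValue {V₁ V₂ : Finset V}
    (hbip : I.graph.IsBipartiteWith (V₁ : Set V) (V₂ : Set V)) (y : Sym2 V → ℝ) :
    ∑ v ∈ V₂, ∑ e ∈ I.inc v, I.w e * I.p e * y e = I.lpValue y := by
  rw [lpValue, Finset.sum_comm' (t' := I.edges) (s' := fun e => V₂.filter (· ∈ e))
    (fun v e => by simp only [mem_inc_iff, Finset.mem_filter]; tauto)]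
  refine Finset.sum_congr rfl fun e he => ?_
  have hex : ∃ v ∈ V₂, v ∈ e := by
    induction e with | _ a b => ?_
    rcases hbip.mem_of_adj (I.mem_edges_iff.1 he) with h | h
    · exact ⟨b, h.2, Sym2.mem_mk_right a b⟩
    · exact ⟨a, h.1, Sym2.mem_mk_left a b⟩
  obtain ⟨v, hv, hve⟩ := hex
  have : V₂.filter (· ∈ e) = {v} := by
    refine Finset.eq_singleton_iff_unique_mem.2 ⟨Finset.mem_filter.2 ⟨hv, hve⟩, fun x hx => ?_⟩
    obtain ⟨hx₂, hxe⟩ := Finset.mem_filter.1 hx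
    exact (eq_or_mem_of_mem_edge hbip he hv hve hxe).resolve_right fun h =>
      Set.disjoint_left.1 hbip.disjoint h hx₂
  rw [this, Finset.sum_singleton]
  ring

end Algorithm

end StochasticGraph

end

theorem theorem4p1 {V : Type*} [Fintype V] (I : StochasticGraph V) (V₁ V₂ : Finset V)
    (hbip : I.graph.IsBipartiteWith (V₁ : Set V) (V₂ : Set V))
    (hunit : ∀ u ∈ V₁, I.t u = 1) :
    (∃ y, I.LPOptimal y) ∧
    ∀ y, I.LPOptimal y →
      (∃ π, I.RoundThenProbe V₂ y π) ∧
      ∀ π, I.RoundThenProbe V₂ y π →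
        I.IsProbingAlgorithm π ∧
        (1 - 1 / Real.exp 1) * ∑ v ∈ V₂, ∑ e ∈ I.inc v, I.w e * I.p e * y e
          ≤ I.expectedWeight π ∧
        ∀ π', I.IsProbingAlgorithm π' →
          (1 - 1 / Real.exp 1) * I.expectedWeight π' ≤ I.expectedWeight π := by
  refine ⟨I.exists_lpOptimal, fun y hy => ⟨StochasticGraph.exists_roundThenProbe hbip
    hy.1.patienceFeasible, fun π hπ => ?_⟩⟩
  obtain ⟨hprob, hval⟩ := hπ.analysis hbip hunit hy.1.patienceFeasible
  have hbound : (1 - 1 / Real.exp 1) * ∑ v ∈ V₂, ∑ e ∈ I.inc v, I.w e * I.p e * y e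
      ≤ I.expectedWeight π := by
    rw [hprob.expectedWeight_eq, Finset.mul_sum]
    exact (Finset.sum_le_sum fun v _ => hy.1.le_vertexValue v).trans hval
  refine ⟨hprob, hbound, fun π' hπ' => le_trans ?_ hbound⟩
  rw [StochasticGraph.sum_sum_inc_eq_lpValue hbip]
  refine mul_le_mul_of_nonneg_left (hy.expectedWeight_le hπ') (sub_nonneg.2 ?_)
  rw [div_le_one (Real.exp_pos 1)]
  exact Real.one_le_exp zero_le_one
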